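/- Let $P>0$ and let $\beta_1,\dots,\beta_p\in\mathbb{C}$ ($p\ge 0$) satisfy $|\beta_k|<1$ for all $k$ and be such that $L_Z(x)=\prod_{k=1}^p(1+\beta_k x)$ has real coefficients; put $H_Z=1/L_Z$. Let $\{Z_i\}_{i\ge1}$ be a zero-mean, real-valued stationary Gaussian process with power spectral density $S_Z(e^{i\theta})=|H_Z(e^{i\theta})|^2=1/\bigl|\prod_{k=1}^p(1+\beta_k e^{i\theta})\bigr|^2$, i.e. $\mathbb{E}[Z_iZ_j]=\frac1{2\pi}\int_{-\pi}^{\pi}S_Z(e^{i\theta})e^{i(i-j)\theta}\,d\theta$ (an AR($p$) Gaussian process), and let $U_1,U_2$ be independent standard normal random variables, independent of $\{Z_i\}$. An SK(2) pair $(V,X)$ consists of a message process $V_1=U_1$, $V_2=U_2$, $V_{i+1}=aV_i+bV_{i-1}$ $(i\ge2)$ with $a,b\in\mathbb{R}$, and a channel input $X_1=U_1$, $X_2=U_2$, $X_i=V_i-\mathbb{E}[V_i\mid Y_1^{i-1}]$ $(i\ge3)$, where $Y_i=X_i+Z_i$ is the channel output. The SK(2) channel capacity is $$C_{\mathrm{SK2}}(P)=\sup_{(V,X)}\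 \varliminf_{n\to\infty}\frac1n I(V_1^n;Y_1^n),$$ the supremum being over all SK(2) pairs with $\varlimsup_{n\to\infty}\frac1n\sum_{i=1}^n\mathbb{E}[X_i^2]\le P$. Let $$\bar I_{\mathrm{SK1}}(P)=\max_{\gamma}\log|\gamma|,$$ over all real $\gamma$ with $|\gamma|>1$ and $(\gamma^2-1)H_Z^2(\gamma^{-1})=P$, and let $$\bar I_{\mathrm{SK2}}(P)=\max_{\gamma_1,\gamma_2}\,2\log\min\{|\gamma_1|,|\gamma_2|\},$$ over all pairs $\gamma_1,\gamma_2\in\mathbb{C}$ with $|\gamma_1|>1$, $|\gamma_2|>1$ that are the two roots of an equation $\lambda^2-a\lambda-b=0$ with $a,b\in\mathbb{R}$, $b\ne0$, and satisfy $$\frac1\Delta\left(\frac{L_{11}}{\gamma_2^2}+\frac{L_{22}}{\gamma_1^2}+\frac{2L_{12}}{\gamma_1\gamma_2}\right)\le P,$$ where $\Delta=(\gamma_1-\gamma_2)^2(L_{11}L_{22}-L_{12}^2)$, $L_{ij}=\dfrac{c_ic_jL_Z(\gamma_i^{-1})L_Z(\gamma_j^{-1})}{\gamma_i\gamma_j-1}$,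 $c_1=\dfrac1{\gamma_1(\gamma_1-\gamma_2)}$, $c_2=\dfrac1{\gamma_2(\gamma_2-\gamma_1)}$; for a double root $\gamma_1=\gamma_2=\gamma$ the left-hand side is understood as its limit as $\gamma_1\to\gamma$ with $\gamma_2=\gamma$ fixed. Then both maxima exist and $$C_{\mathrm{SK2}}(P)\ \ge\ \max\{\bar I_{\mathrm{SK1}}(P),\ \bar I_{\mathrm{SK2}}(P)\}.$$ -/

import Mathlib

open MeasureTheory ProbabilityTheory Filter Topology
open scoped ENNReal

namespace SKChannel

noncomputable section

/-! ### Spectral data of the AR(`p`) noise -/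

/-- The polynomial `L_Z(x) = ∏ₖ (1 + βₖ x)`. The parameters may be complex; the noise is real-valued
exactly when the coefficients of this polynomial are real. -/
def arPoly {p : ℕ} (β : Fin p → ℂ) : Polynomial ℂ :=
  ∏ k, (1 + Polynomial.C (β k) * Polynomial.X)

/-- `L_Z(x) = ∏ₖ (1 + βₖ x)` as a function. -/
def LZ {p : ℕ} (β : Fin p → ℂ) (x : ℂ) : ℂ := (arPoly β).eval x

/-- `H_Z(x) = 1 / L_Z(x)`. -/
def HZ {p : ℕ} (β : Fin p → ℂ) (x : ℂ) : ℂ := 1 / LZ β x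

/-- The power spectral density `S_Z(e^{iθ}) = |H_Z(e^{iθ})|²`. -/
def SZ {p : ℕ} (β : Fin p → ℂ) (θ : ℝ) : ℝ := ‖HZ β (Complex.exp (Complex.I * θ))‖ ^ 2

/-- `Z` is a zero-mean (stationary) Gaussian process whose power spectral density is `SZ β`, that is,
`E[Z_i Z_j] = (1/2π) ∫_{-π}^{π} S_Z(e^{iθ}) e^{i(i-j)θ} dθ`.
The index `i` stands for time `i + 1`. -/
structure IsARNoise {p : ℕ} (β : Fin p → ℂ) {Ω : Type*} [MeasurableSpace Ω] (μ : Measure Ω)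
    (Z : ℕ → Ω → ℝ) : Prop where
  measurable : ∀ i, Measurable (Z i)
  gaussian : IsGaussianProcess Z μ
  mean_zero : ∀ i, ∫ ω, Z i ω ∂μ = 0
  covariance_eq : ∀ i j : ℕ, ((cov[Z i, Z j; μ] : ℝ) : ℂ) =
    (1 / (2 * Real.pi) : ℂ) * ∫ θ in (-Real.pi)..Real.pi,
      (SZ β θ : ℂ) * Complex.exp (Complex.I * (((i : ℂ) - (j : ℂ)) * θ))

/-! ### Mutual information -/

/-- Mutual information `I(X; Y)` (in nats): the Kullback-Leibler divergence of the joint law from the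
product of the marginal laws. -/
def mutualInfo {Ω α γ : Type*} [MeasurableSpace Ω] [MeasurableSpace α] [MeasurableSpace γ]
    (μ : Measure Ω) (X : Ω → α) (Y : Ω → γ) : ℝ≥0∞ :=
  InformationTheory.klDiv (μ.map fun ω => (X ω, Y ω)) ((μ.map X).prod (μ.map Y))

/-- The initial segment `(X_1, …, X_n)` of a process as a random vector. -/
def initSeg {Ω : Type*} (X : ℕ → Ω → ℝ) (n : ℕ) (ω : Ω) : Fin n → ℝ := fun i => X i ω

/-- The mutual information rate `lim (1/n) I(V_1^n; Y_1^n)`, with the limit taken as a limit inferior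
so that it is defined for all processes. -/
def mutualInfoRate {Ω : Type*} [MeasurableSpace Ω] (μ : Measure Ω) (V Y : ℕ → Ω → ℝ) : ℝ≥0∞ :=
  liminf (fun n : ℕ => mutualInfo μ (initSeg V n) (initSeg Y n) / n) atTop

/-! ### The SK(2) coding scheme -/

/-- The σ-algebra generated by the first `n` variables of a process. -/
abbrev past {Ω : Type*} (Y : ℕ → Ω → ℝ) (n : ℕ) : MeasurableSpace Ω :=
  MeasurableSpace.comap (initSeg Y n) inferInstance

/-- The channel output `Y_i = X_i + Z_i`. -/
def channelOutput {Ω : Type*} (X Z : ℕ → Ω → ℝ) (i : ℕ) (ω : Ω) : ℝ := X i ω + Z i ω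

/-- `(V, X)` is an SK(2) pair (message process, channel input) with real recursion coefficients
`a`, `b`, over the channel with noise `Z`; the index `i` stands for time `i + 1`. -/
structure IsSK2Pair {Ω : Type*} [MeasurableSpace Ω] (μ : Measure Ω) (Z : ℕ → Ω → ℝ)
    (U₁ U₂ : Ω → ℝ) (a b : ℝ) (V X : ℕ → Ω → ℝ) : Prop where
  V_one : V 0 = U₁
  V_two : V 1 = U₂
  V_rec : ∀ i, V (i + 2) = fun ω => a * V (i + 1) ω + b * V i ω
  X_measurable : ∀ i, Measurable (X i)
  X_one : X 0 = U₁
  X_two : X 1 = U₂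
  X_eq : ∀ i, 2 ≤ i → X i =ᵐ[μ] fun ω => V i ω - (μ[V i | past (channelOutput X Z) i]) ω

/-- The average power `(1/n) ∑_{i ≤ n} E[X_i²]`. -/
def avgPower {Ω : Type*} [MeasurableSpace Ω] (μ : Measure Ω) (X : ℕ → Ω → ℝ) (n : ℕ) : ℝ≥0∞ :=
  (∑ i ∈ Finset.range n, ∫⁻ ω, ENNReal.ofReal (X i ω ^ 2) ∂μ) / n

/-- The SK(2) channel capacity `C_SK2(P)`: the supremum of the mutual information rate between `V` and
`Y = X + Z` over all SK(2) pairs `(V, X)` whose asymptotic average power is at most `P`. -/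
def sk2Capacity {Ω : Type*} [MeasurableSpace Ω] (μ : Measure Ω) (Z : ℕ → Ω → ℝ)
    (U₁ U₂ : Ω → ℝ) (P : ℝ) : ℝ≥0∞ :=
  sSup {R | ∃ (a b : ℝ) (V X : ℕ → Ω → ℝ), IsSK2Pair μ Z U₁ U₂ a b V X ∧
    limsup (avgPower μ X) atTop ≤ ENNReal.ofReal P ∧
    R = mutualInfoRate μ V (channelOutput X Z)}

/-! ### The closed-form rates -/

/-- The values `log |γ|` over all real `γ` with `|γ| > 1` and `(γ² - 1) H_Z(γ⁻¹)² = P`;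
`Ī_SK1(P)` is the maximum of this set. -/
def sk1Rates {p : ℕ} (β : Fin p → ℂ) (P : ℝ) : Set ℝ :=
  {r | ∃ γ : ℝ, 1 < |γ| ∧ ((γ : ℂ) ^ 2 - 1) * HZ β ((γ : ℂ)⁻¹) ^ 2 = (P : ℂ) ∧
    r = Real.log |γ|}

/-- For `γ = γ₁`, `γ' = γ₂` this is `c₁`; for `γ = γ₂`, `γ' = γ₁` it is `c₂`. -/
def cCoef (γ γ' : ℂ) : ℂ := 1 / (γ * (γ - γ'))

/-- `L_ij = c_i c_j L_Z(γ_i⁻¹) L_Z(γ_j⁻¹) / (γ_i γ_j - 1)`. -/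
def LCoef {p : ℕ} (β : Fin p → ℂ) (ci cj γi γj : ℂ) : ℂ :=
  ci * cj * LZ β γi⁻¹ * LZ β γj⁻¹ / (γi * γj - 1)

/-- The power expression `(1/Δ) (L₁₁/γ₂² + L₂₂/γ₁² + 2 L₁₂/(γ₁γ₂))` with
`Δ = (γ₁ - γ₂)² (L₁₁ L₂₂ - L₁₂²)`, meaningful for `γ₁ ≠ γ₂`. -/
def powerExpr {p : ℕ} (β : Fin p → ℂ) (γ₁ γ₂ : ℂ) : ℂ :=
  let c₁ := cCoef γ₁ γ₂
  let c₂ := cCoef γ₂ γ₁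
  let L₁₁ := LCoef β c₁ c₁ γ₁ γ₁
  let L₂₂ := LCoef β c₂ c₂ γ₂ γ₂
  let L₁₂ := LCoef β c₁ c₂ γ₁ γ₂
  let Δ := (γ₁ - γ₂) ^ 2 * (L₁₁ * L₂₂ - L₁₂ ^ 2)
  1 / Δ * (L₁₁ / γ₂ ^ 2 + L₂₂ / γ₁ ^ 2 + 2 * L₁₂ / (γ₁ * γ₂))

/-- The power constraint at `(γ₁, γ₂)`: the power expression is a real number at most `P`, where for
a double root `γ₁ = γ₂ = γ` it is read as its limit for `γ₁ → γ`, `γ₁ ≠ γ`. -/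
def PowerConstraint {p : ℕ} (β : Fin p → ℂ) (P : ℝ) (γ₁ γ₂ : ℂ) : Prop :=
  (γ₁ ≠ γ₂ ∧ ∃ q : ℝ, q ≤ P ∧ powerExpr β γ₁ γ₂ = (q : ℂ)) ∨
  (γ₁ = γ₂ ∧ ∃ q : ℝ, q ≤ P ∧ Tendsto (fun z => powerExpr β z γ₂) (𝓝[≠] γ₂) (𝓝 (q : ℂ)))

/-- The values `2 log (|γ₁| ∧ |γ₂|)` over all pairs with `|γ₁|, |γ₂| > 1` of (complex) roots of a
characteristic equation `λ² - a λ - b = 0`, `a, b ∈ ℝ`, `b ≠ 0`, that satisfy the power constraint;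
`Ī_SK2(P)` is the maximum of this set. -/
def sk2Rates {p : ℕ} (β : Fin p → ℂ) (P : ℝ) : Set ℝ :=
  {r | ∃ (a b : ℝ) (γ₁ γ₂ : ℂ), b ≠ 0 ∧
    (∀ x : ℂ, x ^ 2 - a * x - b = (x - γ₁) * (x - γ₂)) ∧
    1 < ‖γ₁‖ ∧ 1 < ‖γ₂‖ ∧ PowerConstraint β P γ₁ γ₂ ∧
    r = 2 * Real.log (min ‖γ₁‖ ‖γ₂‖)}

end

end SKChannel

/-! Each feasible root pair yields an explicit SK(2) pair. Its power is bounded by that of a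
suboptimal linear estimator, its rate by a decoding argument.

Power. The polynomial L, used as a filter, whitens `Z` (`covariance_filtered`), so it turns V + Z
into a signal linear in U₁, U₂ plus unit white noise. Estimating V by a strictly causal filter g
applied to this leaves two errors: white noise through g, of variance at most the energy q of g, and
a transient governed by (1 - gL)/(1 - aX - bX²). The transient dies out when 1 - gL vanishes, with
multiplicity, at γ₁⁻¹ and γ₂⁻¹, the zeros of the denominator. Taking g = (AX + BX²)/((1 - γ₁⁻¹X)(1 -
γ₂⁻¹X)), with A, B fixed by this interpolation, makes q equal to the power expression
(`exists_isGain`). The conditional expectation does at least as well in mean square, so the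
asymptotic power is at most q (`tendsto_max_integral_skInput_sq`).

Rate. Bounded power means that the outputs determine V_n and V_{n+1} up to a bounded mean-square
error. Running the recursion backward contracts this error like (n + 1)ρ⁻ⁿ, where ρ is the smaller
root modulus. So for each κ > ρ⁻¹ the outputs locate (U₁, U₂) within κⁿ with probability tending to
1, while under the product of the marginals this event has probability at most 4κ²ⁿ.
`le_klDiv_of_measurableSet` turns the contrast into a rate of 2 log(1/κ), and κ tends to ρ⁻¹. The
SK(1) rate is the case b = 0, where only U₂ is recovered and the factor 2 is lost.

Maxima. After the power expression is rewritten as `powerForm`, which is continuous also at double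
roots, both maximizations reduce to compact sets. For SK(2), Cauchy-Schwarz for g bounds the roots,
and opposite pairs (γ, -γ) with γ near 1 show feasibility. -/

namespace SKChannel

/-! ### Divided differences and the power expression at possibly equal roots -/

section Interpolation

open Polynomial

/-- The divided difference `(L(x) - L(y)) / (x - y)` of a polynomial, as a polynomial expression. -/
noncomputable def divDiff (L : ℂ[X]) (x y : ℂ) : ℂ :=
  ∑ k ∈ Finset.range (L.natDegree + 1),
    L.coeff k * ∑ i ∈ Finset.range k, x ^ i * y ^ (k - 1 - i)

theorem divDiff_mul (L : ℂ[X]) (x y : ℂ) :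
    divDiff L x y * (x - y) = L.eval x - L.eval y := by
  rw [divDiff, Finset.sum_mul, eval_eq_sum_range, eval_eq_sum_range, ← Finset.sum_sub_distrib]
  refine Finset.sum_congr rfl fun k _ => ?_
  rw [mul_assoc, Commute.geom_sum₂_mul (Commute.all x y), mul_sub]

theorem divDiff_comm (L : ℂ[X]) (x y : ℂ) : divDiff L x y = divDiff L y x := by
  refine Finset.sum_congr rfl fun k _ => ?_
  congr 1
  rw [← Finset.sum_range_reflect]
  refine Finset.sum_congr rfl fun i hi => ?_
  have := Finset.mem_range.1 hi
  rw [mul_comm]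
  congr 2
  omega

theorem continuous_divDiff (L : ℂ[X]) : Continuous fun z : ℂ × ℂ => divDiff L z.1 z.2 := by
  unfold divDiff
  fun_prop

theorem conj_divDiff {L : ℂ[X]} (hL : ∀ m, (L.coeff m).im = 0) (x y : ℂ) :
    (starRingEnd ℂ) (divDiff L x y) =
      divDiff L ((starRingEnd ℂ) x) ((starRingEnd ℂ) y) := by
  simp only [divDiff, map_sum, map_mul, map_pow]
  refine Finset.sum_congr rfl fun k _ => ?_
  rw [Complex.conj_eq_iff_im.2 (hL k)]

theorem conj_eval {L : ℂ[X]} (hL : ∀ m, (L.coeff m).im = 0) (x : ℂ) :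
    (starRingEnd ℂ) (L.eval x) = L.eval ((starRingEnd ℂ) x) := by
  simp only [eval_eq_sum_range, map_sum, map_mul, map_pow]
  refine Finset.sum_congr rfl fun k _ => ?_
  rw [Complex.conj_eq_iff_im.2 (hL k)]

/-- Newton interpolation of a polynomial at two (possibly equal) nodes. -/
theorem exists_newton (L : ℂ[X]) (x y : ℂ) :
    ∃ M : ℂ[X], L = C (L.eval x) + C (divDiff L x y) * (X - C x) +
      (X - C x) * (X - C y) * M := by
  set q : ℂ[X] := ∑ k ∈ Finset.range (L.natDegree + 1),
    C (L.coeff k) * ∑ i ∈ Finset.range k, X ^ i * (C x) ^ (k - 1 - i) with hq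
  have h1 : L = C (L.eval x) + q * (X - C x) := by
    have : q * (X - C x) = L - C (L.eval x) := by
      rw [hq, Finset.sum_mul]
      have e : L = ∑ k ∈ Finset.range (L.natDegree + 1), C (L.coeff k) * X ^ k :=
        L.as_sum_range_C_mul_X_pow
      rw [eval_eq_sum_range, map_sum, eq_sub_iff_add_eq]
      refine Eq.trans ?_ e.symm
      rw [← Finset.sum_add_distrib]
      refine Finset.sum_congr rfl fun k _ => ?_
      rw [mul_assoc, Commute.geom_sum₂_mul (Commute.all _ _), C_mul, C_pow]
      ring
    rw [this]; ring
  have h2 : q.eval y = divDiff L x y := by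
    rw [divDiff_comm, hq, divDiff, eval_finsetSum]
    simp [eval_finsetSum]
  obtain ⟨M, hM⟩ := (dvd_iff_isRoot (p := q - C (divDiff L x y)) (a := y)).2 (by simp [h2])
  refine ⟨M, ?_⟩
  have : q = C (divDiff L x y) + (X - C y) * M := by rw [← hM]; ring
  conv_lhs => rw [h1, this]
  ring

/-- The function `(γ² - 1) / L(γ⁻¹)`. -/
noncomputable def gainNum (L : ℂ[X]) (γ : ℂ) : ℂ := (γ ^ 2 - 1) / L.eval γ⁻¹

/-- The divided difference of `gainNum L` at `γ₁, γ₂`. -/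
noncomputable def gainSlope (L : ℂ[X]) (γ₁ γ₂ : ℂ) : ℂ :=
  (γ₁ + γ₂) / L.eval γ₁⁻¹ +
    (γ₂ ^ 2 - 1) * γ₁⁻¹ * γ₂⁻¹ * divDiff L γ₁⁻¹ γ₂⁻¹ / (L.eval γ₁⁻¹ * L.eval γ₂⁻¹)

/-- The intercept at `0` of the line interpolating `gainNum L` at `γ₁, γ₂`. -/
noncomputable def gainIntercept (L : ℂ[X]) (γ₁ γ₂ : ℂ) : ℂ :=
  gainNum L γ₁ - gainSlope L γ₁ γ₂ * γ₁

/-- The power expression in a form that makes sense at double roots. -/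
noncomputable def powerForm (L : ℂ[X]) (γ₁ γ₂ : ℂ) : ℂ :=
  (1 - γ₁⁻¹ * γ₂⁻¹) * ((1 + γ₁⁻¹ * γ₂⁻¹) * (gainSlope L γ₁ γ₂ ^ 2 + gainIntercept L γ₁ γ₂ ^ 2) +
    2 * (γ₁⁻¹ + γ₂⁻¹) * gainSlope L γ₁ γ₂ * gainIntercept L γ₁ γ₂) /
    ((1 - γ₁⁻¹ ^ 2) * (1 - γ₂⁻¹ ^ 2))

variable {L : ℂ[X]}

theorem eval_sub_eval_mul {γ₁ γ₂ : ℂ} (h1 : γ₁ ≠ 0) (h2 : γ₂ ≠ 0) :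
    (L.eval γ₁⁻¹ - L.eval γ₂⁻¹) * (γ₁ * γ₂) = divDiff L γ₁⁻¹ γ₂⁻¹ * (γ₂ - γ₁) := by
  rw [← divDiff_mul]
  field_simp

/-- The formula singles out one node, but it is a divided difference and hence symmetric. Symmetry
makes it real for a conjugate pair, and lets a bound on one root serve for the other. -/
theorem gainSlope_comm {γ₁ γ₂ : ℂ} (h1 : γ₁ ≠ 0) (h2 : γ₂ ≠ 0) (hL1 : L.eval γ₁⁻¹ ≠ 0)
    (hL2 : L.eval γ₂⁻¹ ≠ 0) : gainSlope L γ₁ γ₂ = gainSlope L γ₂ γ₁ := by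
  have h := eval_sub_eval_mul (L := L) h1 h2
  unfold gainSlope
  rw [divDiff_comm L γ₂⁻¹]
  generalize divDiff L γ₁⁻¹ γ₂⁻¹ = D at *
  generalize L.eval γ₁⁻¹ = l1 at *
  generalize L.eval γ₂⁻¹ = l2 at *
  field_simp
  linear_combination (-(γ₁ + γ₂)) * h

theorem gainSlope_mul_sub {γ₁ γ₂ : ℂ} (h1 : γ₁ ≠ 0) (h2 : γ₂ ≠ 0) (hL1 : L.eval γ₁⁻¹ ≠ 0)
    (hL2 : L.eval γ₂⁻¹ ≠ 0) :
    gainSlope L γ₁ γ₂ * (γ₁ - γ₂) = gainNum L γ₁ - gainNum L γ₂ := by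
  have h := eval_sub_eval_mul (L := L) h1 h2
  unfold gainSlope gainNum
  generalize divDiff L γ₁⁻¹ γ₂⁻¹ = D at *
  generalize L.eval γ₁⁻¹ = l1 at *
  generalize L.eval γ₂⁻¹ = l2 at *
  field_simp
  linear_combination (γ₂ ^ 2 - 1) * h

theorem gainIntercept_comm {γ₁ γ₂ : ℂ} (h1 : γ₁ ≠ 0) (h2 : γ₂ ≠ 0) (hL1 : L.eval γ₁⁻¹ ≠ 0)
    (hL2 : L.eval γ₂⁻¹ ≠ 0) : gainIntercept L γ₁ γ₂ = gainIntercept L γ₂ γ₁ := by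
  unfold gainIntercept
  rw [← gainSlope_comm h1 h2 hL1 hL2]
  linear_combination -gainSlope_mul_sub h1 h2 hL1 hL2

theorem powerForm_comm {γ₁ γ₂ : ℂ} (h1 : γ₁ ≠ 0) (h2 : γ₂ ≠ 0) (hL1 : L.eval γ₁⁻¹ ≠ 0)
    (hL2 : L.eval γ₂⁻¹ ≠ 0) : powerForm L γ₁ γ₂ = powerForm L γ₂ γ₁ := by
  unfold powerForm
  rw [gainSlope_comm h1 h2 hL1 hL2, gainIntercept_comm h1 h2 hL1 hL2, mul_comm γ₁⁻¹, add_comm γ₁⁻¹,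
    mul_comm (1 - γ₁⁻¹ ^ 2)]

/-- At distinct nodes the slope is an honest difference quotient, and the factors γ₁ - γ₂ in the
denominators cancel. -/
theorem powerExpr_eq_powerForm {p : ℕ} (β : Fin p → ℂ) {γ₁ γ₂ : ℂ} (h1 : γ₁ ≠ 0) (h2 : γ₂ ≠ 0)
    (hne : γ₁ ≠ γ₂) (h11 : γ₁ ^ 2 - 1 ≠ 0) (h22 : γ₂ ^ 2 - 1 ≠ 0) (h12 : γ₁ * γ₂ - 1 ≠ 0)
    (hL1 : LZ β γ₁⁻¹ ≠ 0) (hL2 : LZ β γ₂⁻¹ ≠ 0) :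
    powerExpr β γ₁ γ₂ = powerForm (arPoly β) γ₁ γ₂ := by
  have hs : γ₁ - γ₂ ≠ 0 := sub_ne_zero.2 hne
  have hslope : gainSlope (arPoly β) γ₁ γ₂ =
      (gainNum (arPoly β) γ₁ - gainNum (arPoly β) γ₂) / (γ₁ - γ₂) := by
    rw [eq_div_iff hs, gainSlope_mul_sub h1 h2 hL1 hL2]
  unfold powerForm powerExpr gainIntercept
  rw [hslope]
  unfold gainNum
  simp only [LCoef, cCoef, LZ] at *
  generalize (arPoly β).eval γ₁⁻¹ = l1 at *
  generalize (arPoly β).eval γ₂⁻¹ = l2 at *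
  have hs' : γ₂ - γ₁ ≠ 0 := sub_ne_zero.2 hne.symm
  have e11 : γ₁ * γ₁ - 1 ≠ 0 := by rwa [← sq]
  have e22 : γ₂ * γ₂ - 1 ≠ 0 := by rwa [← sq]
  -- A 2 × 2 Cauchy determinant: (γ₁γ₂ - 1)² - (γ₁² - 1)(γ₂² - 1) = (γ₁ - γ₂)².
  have hd : (1 / (γ₁ * (γ₁ - γ₂)) * (1 / (γ₁ * (γ₁ - γ₂))) * l1 * l1 / (γ₁ * γ₁ - 1)) *
      (1 / (γ₂ * (γ₂ - γ₁)) * (1 / (γ₂ * (γ₂ - γ₁))) * l2 * l2 / (γ₂ * γ₂ - 1)) -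
      (1 / (γ₁ * (γ₁ - γ₂)) * (1 / (γ₂ * (γ₂ - γ₁))) * l1 * l2 / (γ₁ * γ₂ - 1)) ^ 2 =
      l1 ^ 2 * l2 ^ 2 / (γ₁ ^ 2 * γ₂ ^ 2 * (γ₁ ^ 2 - 1) * (γ₂ ^ 2 - 1) * (γ₁ * γ₂ - 1) ^ 2 *
        (γ₁ - γ₂) ^ 2) := by
    have : γ₂ - γ₁ = -(γ₁ - γ₂) := by ring
    rw [this]
    field_simp
    ring
  rw [hd]
  have : γ₂ - γ₁ = -(γ₁ - γ₂) := by ring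
  rw [this]
  have hx : (1 - γ₁⁻¹ ^ 2) * (1 - γ₂⁻¹ ^ 2) =
      (γ₁ ^ 2 - 1) * (γ₂ ^ 2 - 1) / (γ₁ ^ 2 * γ₂ ^ 2) := by field_simp
  rw [hx]
  field_simp
  ring

/-- The noise-filtered interpolation identity behind the stationary estimator: the polynomial
`1 - s X + m X² - (α X + β X²) L` vanishes at `γ₁⁻¹` and `γ₂⁻¹`, with multiplicity. -/
theorem exists_interpolation_quotient {γ₁ γ₂ : ℂ} (h1 : γ₁ ≠ 0) (h2 : γ₂ ≠ 0)
    (hL1 : L.eval γ₁⁻¹ ≠ 0) (hL2 : L.eval γ₂⁻¹ ≠ 0) :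
    ∃ R : ℂ[X], 1 - C (γ₁⁻¹ + γ₂⁻¹) * X + C (γ₁⁻¹ * γ₂⁻¹) * X ^ 2 -
      (C ((1 - γ₁⁻¹ * γ₂⁻¹) * gainSlope L γ₁ γ₂) * X +
        C ((1 - γ₁⁻¹ * γ₂⁻¹) * gainIntercept L γ₁ γ₂) * X ^ 2) * L =
      (1 - C (γ₁ + γ₂) * X + C (γ₁ * γ₂) * X ^ 2) * R := by
  obtain ⟨M, hM⟩ := exists_newton L γ₁⁻¹ γ₂⁻¹
  have h := eval_sub_eval_mul (L := L) h1 h2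
  -- Leibniz rule for divided differences, applied to the product of `gainNum L γ` and L(γ⁻¹), which
  -- is γ² - 1 with divided difference γ₁ + γ₂.
  have hK : gainSlope L γ₁ γ₂ * L.eval γ₂⁻¹ - gainNum L γ₁ * divDiff L γ₁⁻¹ γ₂⁻¹ * (γ₁⁻¹ * γ₂⁻¹) =
      γ₁ + γ₂ := by
    rw [gainSlope, gainNum]
    generalize divDiff L γ₁⁻¹ γ₂⁻¹ = D at *
    generalize L.eval γ₁⁻¹ = l1 at *
    generalize L.eval γ₂⁻¹ = l2 at *
    field_simp
    linear_combination (-(γ₁ + γ₂)) * h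
  have hf : gainNum L γ₁ * L.eval γ₁⁻¹ = γ₁ ^ 2 - 1 := by
    rw [gainNum, div_mul_cancel₀ _ hL1]
  have hd := divDiff_mul L γ₁⁻¹ γ₂⁻¹
  have hx1 : γ₁ * γ₁⁻¹ = 1 := mul_inv_cancel₀ h1
  have hx2 : γ₂ * γ₂⁻¹ = 1 := mul_inv_cancel₀ h2
  rw [gainIntercept]
  set δ := gainSlope L γ₁ γ₂
  set D := divDiff L γ₁⁻¹ γ₂⁻¹
  set l1 := L.eval γ₁⁻¹
  set f1 := gainNum L γ₁
  set m := γ₁⁻¹ * γ₂⁻¹ with hm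
  set A := (1 - m) * δ with hA
  set B := (1 - m) * (f1 - δ * γ₁) with hB
  clear_value δ D l1 f1
  have ha : γ₁ * m = γ₂⁻¹ := by rw [hm]; linear_combination γ₂⁻¹ * hx1
  have hb : γ₂ * m = γ₁⁻¹ := by rw [hm]; linear_combination γ₁⁻¹ * hx2
  have hmm : γ₁ * γ₂ * m = 1 := by rw [hm]; field_simp
  -- With L replaced by its Newton form, `e1`, `e2`, `e3` match the coefficients of X, X², X³
  -- against (1 - (γ₁ + γ₂)X + γ₁γ₂X²)(1 - BDmX). The remainder M needs no matching: by `c6` its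
  -- factor is already a multiple of the quadratic.
  have e1 : (γ₁⁻¹ + γ₂⁻¹) + A * (l1 - D * γ₁⁻¹) = B * D * m + (γ₁ + γ₂) := by
    rw [hA, hB]
    linear_combination (1 - m) * hK - (1 - m) * δ * hd - ha - hb + (1 - m) * δ * D * ha
  have e2 : m - A * D - B * (l1 - D * γ₁⁻¹) = γ₁ * γ₂ + (γ₁ + γ₂) * (B * D * m) := by
    have : (1 - m) * (f1 - δ * γ₁) * D * ((γ₁ + γ₂) * m - γ₁⁻¹ - γ₂⁻¹) = 0 := by
      linear_combination (1 - m) * (f1 - δ * γ₁) * D * (ha + hb)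
    rw [hA, hB]
    linear_combination (1 - m) * γ₁ * hK - (1 - m) * γ₁ * δ * hd - (1 - m) * hf - this +
      (-1) * hmm + (1 - m) * δ * D * hx1 + (1 - m) * f1 * D * ha
  have e3 : γ₁ * γ₂ * (B * D * m) = B * D := by linear_combination B * D * hmm
  refine ⟨1 - C (B * D * m) * X - C m * (C A * X + C B * X ^ 2) * M, ?_⟩
  conv_lhs => rw [hM]
  have c1 := congrArg C e1
  have c2 := congrArg C e2
  have c3 := congrArg C e3
  have c4 : (C γ₁ * C γ₁⁻¹ : ℂ[X]) = 1 := by rw [← C_mul, mul_inv_cancel₀ h1, C_1]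
  have c5 : (C γ₂ * C γ₂⁻¹ : ℂ[X]) = 1 := by rw [← C_mul, mul_inv_cancel₀ h2, C_1]
  have c6 : (X - C γ₁⁻¹) * (X - C γ₂⁻¹) =
      C m * (1 - C (γ₁ + γ₂) * X + C (γ₁ * γ₂) * X ^ 2) := by
    rw [hm]
    simp only [C_add, C_mul]
    linear_combination (-X) * (X - C γ₂⁻¹) * c4 - X * (C γ₁ * C γ₁⁻¹ * X - C γ₁⁻¹) * c5
  clear_value A B m
  simp only [C_add, C_sub, C_mul] at c1 c2 c3 c6 ⊢
  linear_combination (-X) * c1 + X ^ 2 * c2 + X ^ 3 * c3 - (C A * X + C B * X ^ 2) * M * c6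

end Interpolation

/-! ### Second-order recursions: growth and energy -/

section Recurrence

/-- The recursion factors into two first-order ones: w(n+1) - x₁ w(n) is geometric with ratio x₂ and
drives a first-order recursion for w. The factor n + 1 absorbs resonance, so equal roots need no
separate case. -/
theorem exists_norm_le_of_recurrence {x₁ x₂ : ℂ} {ρ : ℝ} (hρ : 0 < ρ) (h1 : ‖x₁‖ ≤ ρ)
    (h2 : ‖x₂‖ ≤ ρ) (w : ℕ → ℂ)
    (hw : ∀ n, w (n + 2) = (x₁ + x₂) * w (n + 1) - x₁ * x₂ * w n) :
    ∃ K : ℝ, 0 ≤ K ∧ ∀ n, ‖w n‖ ≤ K * (n + 1) * ρ ^ n := by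
  set t : ℕ → ℂ := fun n => w (n + 1) - x₁ * w n with ht
  have ht1 : ∀ n, ‖t n‖ ≤ ‖t 0‖ * ρ ^ n := by
    intro n
    induction n with
    | zero => simp
    | succ n ih =>
      have : t (n + 1) = x₂ * t n := by simp only [ht, hw]; ring
      rw [this, norm_mul, pow_succ]
      calc ‖x₂‖ * ‖t n‖ ≤ ρ * (‖t 0‖ * ρ ^ n) := by gcongr
        _ = _ := by ring
  refine ⟨‖w 0‖ + ‖t 0‖ / ρ, by positivity, fun n => ?_⟩
  induction n with
  | zero =>
    have : 0 ≤ ‖t 0‖ / ρ := by positivity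
    simp only [CharP.cast_eq_zero, zero_add, mul_one, pow_zero]
    linarith
  | succ n ih =>
    have e : w (n + 1) = x₁ * w n + t n := by simp only [ht]; ring
    have e2 : ‖t 0‖ * ρ ^ n = ‖t 0‖ / ρ * ρ ^ (n + 1) := by rw [pow_succ]; field_simp
    have hpos : 0 ≤ ‖w 0‖ * ρ ^ (n + 1) := by positivity
    calc ‖w (n + 1)‖ ≤ ‖x₁‖ * ‖w n‖ + ‖t n‖ := by
          rw [e]; exact (norm_add_le _ _).trans (by rw [norm_mul])
      _ ≤ ρ * ((‖w 0‖ + ‖t 0‖ / ρ) * (n + 1) * ρ ^ n) + ‖t 0‖ / ρ * ρ ^ (n + 1) := by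
          rw [← e2]
          gcongr
          exact ht1 n
      _ ≤ (‖w 0‖ + ‖t 0‖ / ρ) * ((n + 1 : ℕ) + 1) * ρ ^ (n + 1) := by
          push_cast
          have : (‖w 0‖ + ‖t 0‖ / ρ) * ((n + 1 : ℝ) + 1) * ρ ^ (n + 1) =
            ρ * ((‖w 0‖ + ‖t 0‖ / ρ) * (n + 1) * ρ ^ n) + ‖t 0‖ / ρ * ρ ^ (n + 1) +
              ‖w 0‖ * ρ ^ (n + 1) := by rw [pow_succ]; ring
          linarith

/-- The impulse response of the recursion `u (n + 2) = s * u (n + 1) - m * u n`. -/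
def impulse (s m : ℝ) : ℕ → ℝ
  | 0 => 1
  | 1 => s
  | n + 2 => s * impulse s m (n + 1) - m * impulse s m n

open PowerSeries in
theorem mk_impulse_mul (s m : ℝ) :
    (1 - C s * X + C m * X ^ 2) * mk (impulse s m) = 1 := by
  ext n
  have e : (1 - C s * X + C m * X ^ 2) * mk (impulse s m) =
    mk (impulse s m) - C s * (X * mk (impulse s m)) + C m * (X ^ 2 * mk (impulse s m)) := by ring
  rw [e]
  simp only [map_add, map_sub, coeff_C_mul, coeff_one]
  match n with
  | 0 => simp [impulse, coeff_X_pow_mul']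
  | 1 => simp [impulse, coeff_X_pow_mul', coeff_succ_X_mul]
  | n + 2 => simp [impulse, coeff_X_pow_mul', coeff_succ_X_mul]

variable {x₁ x₂ : ℂ} {s m : ℝ}

theorem exists_impulse_le (hs : x₁ + x₂ = s) (hm : x₁ * x₂ = m) {ρ : ℝ} (hρ : 0 < ρ)
    (h1 : ‖x₁‖ ≤ ρ) (h2 : ‖x₂‖ ≤ ρ) :
    ∃ K : ℝ, 0 ≤ K ∧ ∀ n, |impulse s m n| ≤ K * (n + 1) * ρ ^ n := by
  obtain ⟨K, hK0, hK⟩ := exists_norm_le_of_recurrence hρ h1 h2 (fun n => (impulse s m n : ℂ))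
    (fun n => by rw [hs, hm]; simp [impulse])
  exact ⟨K, hK0, fun n => by simpa using hK n⟩

theorem summable_succ_mul_pow {ρ : ℝ} (h0 : 0 ≤ ρ) (h1 : ρ < 1) :
    Summable fun n : ℕ => ((n : ℝ) + 1) * ρ ^ n := by
  have h := (summable_pow_mul_geometric_of_norm_lt_one (R := ℝ) 1
    (by rwa [Real.norm_of_nonneg h0] : ‖ρ‖ < 1)).add
    (summable_geometric_of_lt_one h0 h1)
  refine h.congr fun n => ?_
  simp only [pow_one]; ring

theorem exists_max_norm_lt_one (h1 : ‖x₁‖ < 1) (h2 : ‖x₂‖ < 1) :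
    ∃ ρ : ℝ, 0 < ρ ∧ ρ < 1 ∧ ‖x₁‖ ≤ ρ ∧ ‖x₂‖ ≤ ρ :=
  ⟨max (1 / 2) (max ‖x₁‖ ‖x₂‖), by positivity, by simp [h1, h2]; norm_num, by simp, by simp⟩

theorem summable_abs_impulse (hs : x₁ + x₂ = s) (hm : x₁ * x₂ = m) (h1 : ‖x₁‖ < 1)
    (h2 : ‖x₂‖ < 1) : Summable fun n => |impulse s m n| := by
  obtain ⟨ρ, h0, hρ1, k1, k2⟩ := exists_max_norm_lt_one h1 h2
  obtain ⟨K, hK0, hK⟩ := exists_impulse_le hs hm h0 k1 k2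
  refine Summable.of_nonneg_of_le (fun _ => abs_nonneg _) hK ?_
  simpa [mul_assoc] using (summable_succ_mul_pow h0.le hρ1).mul_left K

theorem exists_abs_impulse_le (hs : x₁ + x₂ = s) (hm : x₁ * x₂ = m) (h1 : ‖x₁‖ < 1)
    (h2 : ‖x₂‖ < 1) : ∃ K : ℝ, ∀ n, |impulse s m n| ≤ K :=
  ⟨_, fun n => (summable_abs_impulse hs hm h1 h2).le_tsum n fun _ _ => abs_nonneg _⟩

theorem summable_impulse_sq (hs : x₁ + x₂ = s) (hm : x₁ * x₂ = m) (h1 : ‖x₁‖ < 1)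
    (h2 : ‖x₂‖ < 1) : Summable fun n => impulse s m n ^ 2 := by
  obtain ⟨K, hK⟩ := exists_abs_impulse_le hs hm h1 h2
  refine Summable.of_nonneg_of_le (fun _ => sq_nonneg _) (fun n => ?_)
    ((summable_abs_impulse hs hm h1 h2).mul_left K)
  rw [← sq_abs, sq]
  exact mul_le_mul_of_nonneg_right (hK n) (abs_nonneg _)

theorem summable_impulse_mul_succ (hs : x₁ + x₂ = s) (hm : x₁ * x₂ = m) (h1 : ‖x₁‖ < 1)
    (h2 : ‖x₂‖ < 1) : Summable fun n => impulse s m n * impulse s m (n + 1) := by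
  obtain ⟨K, hK⟩ := exists_abs_impulse_le hs hm h1 h2
  refine Summable.of_norm_bounded ((summable_abs_impulse hs hm h1 h2).mul_right K) fun n => ?_
  rw [norm_mul]
  exact mul_le_mul_of_nonneg_left (hK _) (abs_nonneg _)

/-- Yule-Walker equations: multiply the recursion by its middle term, or square it, and sum over n.
The two linear relations determine the energy and the lag-one correlation. -/
theorem tsum_impulse_relations (hs : x₁ + x₂ = s) (hm : x₁ * x₂ = m) (h1 : ‖x₁‖ < 1)
    (h2 : ‖x₂‖ < 1) :
    (1 + m) * ∑' n, impulse s m n * impulse s m (n + 1) = s * ∑' n, impulse s m n ^ 2 ∧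
    (1 - s ^ 2 - m ^ 2) * (∑' n, impulse s m n ^ 2) +
      2 * s * m * (∑' n, impulse s m n * impulse s m (n + 1)) = 1 := by
  have S0 := summable_impulse_sq hs hm h1 h2
  have S1 := summable_impulse_mul_succ hs hm h1 h2
  set T0 := ∑' n, impulse s m n ^ 2 with hT0
  set T1 := ∑' n, impulse s m n * impulse s m (n + 1) with hT1
  have H0 : HasSum (fun n => impulse s m n ^ 2) T0 := S0.hasSum
  have H1 : HasSum (fun n => impulse s m n * impulse s m (n + 1)) T1 := S1.hasSum
  have H0' : HasSum (fun n => impulse s m (n + 1) ^ 2) (T0 - 1) := by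
    have := (hasSum_nat_add_iff' 1).2 H0
    simpa [impulse] using this
  have H0'' : HasSum (fun n => impulse s m (n + 2) ^ 2) (T0 - 1 - s ^ 2) := by
    have := (hasSum_nat_add_iff' 2).2 H0
    simpa [impulse, Finset.sum_range_succ, sub_sub] using this
  have H1' : HasSum (fun n => impulse s m (n + 1) * impulse s m (n + 2)) (T1 - s) := by
    have := (hasSum_nat_add_iff' 1).2 H1
    simpa [impulse] using this
  constructor
  · have A : HasSum (fun n => impulse s m (n + 1) * impulse s m (n + 2))
        (s * (T0 - 1) - m * T1) := by
      refine ((H0'.mul_left s).sub (H1.mul_left m)).congr_fun ?_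
      intro n
      simp only [impulse]; ring
    have := H1'.unique A
    linarith
  · have B : HasSum (fun n => impulse s m (n + 2) ^ 2)
        (s ^ 2 * (T0 - 1) - 2 * s * m * T1 + m ^ 2 * T0) := by
      refine (((H0'.mul_left (s ^ 2)).sub (H1.mul_left (2 * s * m))).add
        (H0.mul_left (m ^ 2))).congr_fun ?_
      intro n
      simp only [impulse]; ring
    have := H0''.unique B
    linarith

end Recurrence

/-! ### The rational filter: energy and value at a node -/

section Gain

/-- The power series `(A X + B X²) / (1 - s X + m X²)`. -/
noncomputable def gainSeries (s m A B : ℝ) : PowerSeries ℝ :=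
  (PowerSeries.C A * PowerSeries.X + PowerSeries.C B * PowerSeries.X ^ 2) *
    PowerSeries.mk (impulse s m)

variable {s m A B : ℝ}

theorem gainSeries_eq : gainSeries s m A B =
    PowerSeries.C A * (PowerSeries.X * PowerSeries.mk (impulse s m)) +
      PowerSeries.C B * (PowerSeries.X ^ 2 * PowerSeries.mk (impulse s m)) := by
  rw [gainSeries]; ring

theorem coeff_gainSeries_zero : PowerSeries.coeff 0 (gainSeries s m A B) = 0 := by
  rw [gainSeries_eq]
  simp

theorem coeff_gainSeries_one : PowerSeries.coeff 1 (gainSeries s m A B) = A := by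
  rw [gainSeries_eq]
  simp [PowerSeries.coeff_X_pow_mul', PowerSeries.coeff_succ_X_mul, impulse]

theorem coeff_gainSeries_add_two (n : ℕ) : PowerSeries.coeff (n + 2) (gainSeries s m A B) =
    A * impulse s m (n + 1) + B * impulse s m n := by
  rw [gainSeries_eq]
  simp [PowerSeries.coeff_X_pow_mul', PowerSeries.coeff_succ_X_mul]

variable {x₁ x₂ : ℂ}

theorem one_sub_mul_ne_zero {x y : ℂ} (h1 : ‖x‖ < 1) (h2 : ‖y‖ < 1) : 1 - x * y ≠ 0 := by
  intro h
  have h3 : x * y = 1 := (sub_eq_zero.1 h).symm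
  have h4 : ‖x‖ * ‖y‖ = 1 := by rw [← norm_mul, h3, norm_one]
  nlinarith [norm_nonneg x, norm_nonneg y]

/-- From index 2 on the coefficients are A u(n+1) + B u(n), with u the impulse response, so the
energy is (A² + B²)T₀ + 2AB T₁. Solving the Yule-Walker equations for T₀, T₁ gives the closed form.
-/
theorem hasSum_gainSeries_sq (hs : x₁ + x₂ = s) (hm : x₁ * x₂ = m) (h1 : ‖x₁‖ < 1)
    (h2 : ‖x₂‖ < 1) :
    ∃ q : ℝ, HasSum (fun n => PowerSeries.coeff n (gainSeries s m A B) ^ 2) q ∧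
      (q : ℂ) * ((1 - x₁ * x₂) * ((1 - x₁ ^ 2) * (1 - x₂ ^ 2))) =
        (1 + x₁ * x₂) * (A ^ 2 + B ^ 2) + 2 * (x₁ + x₂) * A * B := by
  have S0 := summable_impulse_sq hs hm h1 h2
  have S1 := summable_impulse_mul_succ hs hm h1 h2
  obtain ⟨r1, r2⟩ := tsum_impulse_relations hs hm h1 h2
  set T0 := ∑' n, impulse s m n ^ 2 with hT0
  set T1 := ∑' n, impulse s m n * impulse s m (n + 1) with hT1
  have H0 : HasSum (fun n => impulse s m n ^ 2) T0 := S0.hasSum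
  have H1 : HasSum (fun n => impulse s m n * impulse s m (n + 1)) T1 := S1.hasSum
  have H0' : HasSum (fun n => impulse s m (n + 1) ^ 2) (T0 - 1) := by
    have := (hasSum_nat_add_iff' 1).2 H0
    simpa [impulse] using this
  refine ⟨(A ^ 2 + B ^ 2) * T0 + 2 * A * B * T1, ?_, ?_⟩
  · rw [← hasSum_nat_add_iff' 2]
    have := ((H0'.mul_left (A ^ 2)).add (H0.mul_left (B ^ 2))).add (H1.mul_left (2 * A * B))
    simp only [Finset.sum_range_succ, Finset.sum_range_zero, coeff_gainSeries_zero,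
      coeff_gainSeries_one, coeff_gainSeries_add_two]
    have e : (A ^ 2 + B ^ 2) * T0 + 2 * A * B * T1 - (0 + 0 ^ 2 + A ^ 2) =
        A ^ 2 * (T0 - 1) + B ^ 2 * T0 + 2 * A * B * T1 := by ring
    rw [e]
    exact this.congr_fun fun n => by ring
  · have c1 : (1 + (m : ℂ)) * T1 = s * T0 := by exact_mod_cast r1
    have c2 : (1 - (s : ℂ) ^ 2 - m ^ 2) * T0 + 2 * s * m * T1 = 1 := by exact_mod_cast r2
    have hD : (1 - x₁ ^ 2) * (1 - x₂ ^ 2) = (1 + (m : ℂ)) ^ 2 - s ^ 2 := by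
      rw [← hs, ← hm]; ring
    rw [hD, hm, hs]
    have k0 : (T0 : ℂ) * ((1 - m) * ((1 + m) ^ 2 - s ^ 2)) = 1 + m := by
      linear_combination (1 + (m : ℂ)) * c2 - 2 * s * m * c1
    have k1 : (T1 : ℂ) * ((1 - m) * ((1 + m) ^ 2 - s ^ 2)) = s := by
      have hne : (1 + (m : ℂ)) ≠ 0 := by
        have := one_sub_mul_ne_zero (x := -x₁) (by simpa) h2
        rw [neg_mul, hm] at this
        simpa using this
      apply mul_left_cancel₀ hne
      linear_combination ((1 - (m : ℂ)) * ((1 + m) ^ 2 - s ^ 2)) * c1 + s * k0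
    push_cast
    linear_combination ((A : ℂ) ^ 2 + B ^ 2) * k0 + 2 * A * B * k1

theorem tendsto_coeff_gainSeries (hs : x₁ + x₂ = s) (hm : x₁ * x₂ = m) (h1 : ‖x₁‖ < 1)
    (h2 : ‖x₂‖ < 1) :
    Tendsto (fun n => PowerSeries.coeff n (gainSeries s m A B)) atTop (𝓝 0) := by
  have h := (summable_abs_impulse hs hm h1 h2).of_abs.tendsto_atTop_zero
  rw [← tendsto_add_atTop_iff_nat 2]
  simp only [coeff_gainSeries_add_two]
  simpa using (((tendsto_add_atTop_iff_nat 1).2 h).const_mul A).add (h.const_mul B)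

/-- At X = x₁ the denominator 1 - sX + mX² is (1 - x₁²)(1 - x₁x₂). The value enters the
Cauchy-Schwarz bound on the roots. -/
theorem hasSum_gainSeries_mul_pow (hs : x₁ + x₂ = s) (hm : x₁ * x₂ = m) (h1 : ‖x₁‖ < 1)
    (h2 : ‖x₂‖ < 1) :
    HasSum (fun n => ((PowerSeries.coeff n (gainSeries s m A B) : ℝ) : ℂ) * x₁ ^ n)
      ((A * x₁ + B * x₁ ^ 2) / ((1 - x₁ ^ 2) * (1 - x₁ * x₂))) := by
  have S : Summable fun n => (impulse s m n : ℂ) * x₁ ^ n := by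
    refine Summable.of_norm_bounded (summable_abs_impulse hs hm h1 h2) fun n => ?_
    rw [norm_mul, norm_pow, Complex.norm_real, Real.norm_eq_abs]
    exact mul_le_of_le_one_right (abs_nonneg _) (pow_le_one₀ (norm_nonneg _) h1.le)
  obtain ⟨T, hT⟩ := S
  have H1 : HasSum (fun n => (impulse s m (n + 1) : ℂ) * x₁ ^ (n + 1)) (T - 1) := by
    have := (hasSum_nat_add_iff' 1).2 hT
    simpa [impulse] using this
  have H2 : HasSum (fun n => (impulse s m (n + 2) : ℂ) * x₁ ^ (n + 2)) (T - 1 - s * x₁) := by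
    have := (hasSum_nat_add_iff' 2).2 hT
    simpa [impulse, Finset.sum_range_succ, sub_sub] using this
  have H2' : HasSum (fun n => (impulse s m (n + 2) : ℂ) * x₁ ^ (n + 2))
      (s * x₁ * (T - 1) - m * x₁ ^ 2 * T) := by
    refine ((H1.mul_left (s * x₁)).sub (hT.mul_left (m * x₁ ^ 2))).congr_fun ?_
    intro n
    simp only [impulse]; push_cast; ring
  have e := H2.unique H2'
  have n1 : (1 - x₁ ^ 2) ≠ 0 := by rw [sq]; exact one_sub_mul_ne_zero h1 h1
  have n2 := one_sub_mul_ne_zero h1 h2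
  have hTT : T * ((1 - x₁ ^ 2) * (1 - x₁ * x₂)) = 1 := by
    have : (1 - x₁ ^ 2) * (1 - x₁ * x₂) = 1 - s * x₁ + m * x₁ ^ 2 := by
      rw [← hs, ← hm]; ring
    rw [this]; linear_combination e
  rw [← hasSum_nat_add_iff' 2]
  simp only [Finset.sum_range_succ, Finset.sum_range_zero, coeff_gainSeries_zero,
    coeff_gainSeries_one, coeff_gainSeries_add_two]
  have e' : (A * x₁ + B * x₁ ^ 2) / ((1 - x₁ ^ 2) * (1 - x₁ * x₂)) = (A * x₁ + B * x₁ ^ 2) * T := by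
    rw [div_eq_iff (mul_ne_zero n1 n2)]
    linear_combination (-(A * x₁ + B * x₁ ^ 2)) * hTT
  have e'' : (A * x₁ + B * x₁ ^ 2) * T - (0 + ((0 : ℝ) : ℂ) * x₁ ^ 0 + A * x₁ ^ 1) =
      A * x₁ * (T - 1) + B * x₁ ^ 2 * T := by push_cast; ring
  rw [e', e'']
  exact ((H1.mul_left (A * x₁)).add (hT.mul_left (B * x₁ ^ 2))).congr_fun
    fun n => by push_cast; ring

/-- Cauchy-Schwarz for the value at `x` of a power series without constant term. -/
theorem norm_sq_le_of_hasSum {c : ℕ → ℝ} {q : ℝ} (h0 : c 0 = 0) (hq : HasSum (fun n => c n ^ 2) q)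
    {x w : ℂ} (hx : ‖x‖ < 1) (hw : HasSum (fun n => (c n : ℂ) * x ^ n) w) :
    ‖w‖ ^ 2 * (1 - ‖x‖ ^ 2) ≤ q * ‖x‖ ^ 2 := by
  have hx2 : ‖x‖ ^ 2 < 1 := by
    rw [sq_lt_one_iff₀ (norm_nonneg _)]; exact hx
  have hgeo : HasSum (fun n : ℕ => ‖x‖ ^ 2 * (‖x‖ ^ 2) ^ n) (‖x‖ ^ 2 * (1 - ‖x‖ ^ 2)⁻¹) :=
    (hasSum_geometric_of_lt_one (sq_nonneg _) hx2).mul_left _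
  have hw' : HasSum (fun n => (c (n + 1) : ℂ) * x ^ (n + 1)) w := by
    have := (hasSum_nat_add_iff' 1).2 hw
    simpa [h0] using this
  have hq' : HasSum (fun n => c (n + 1) ^ 2) q := by
    have := (hasSum_nat_add_iff' 1).2 hq
    simpa [h0] using this
  have key : ∀ n, ‖∑ i ∈ Finset.range n, (c (i + 1) : ℂ) * x ^ (i + 1)‖ ^ 2 ≤
      (∑ i ∈ Finset.range n, c (i + 1) ^ 2) *
        ∑ i ∈ Finset.range n, ‖x‖ ^ 2 * (‖x‖ ^ 2) ^ i := by
    intro n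
    calc ‖∑ i ∈ Finset.range n, (c (i + 1) : ℂ) * x ^ (i + 1)‖ ^ 2
        ≤ (∑ i ∈ Finset.range n, |c (i + 1)| * ‖x‖ ^ (i + 1)) ^ 2 := by
          gcongr
          refine (norm_sum_le _ _).trans (le_of_eq ?_)
          simp
      _ ≤ (∑ i ∈ Finset.range n, |c (i + 1)| ^ 2) *
          ∑ i ∈ Finset.range n, (‖x‖ ^ (i + 1)) ^ 2 := Finset.sum_mul_sq_le_sq_mul_sq _ _ _
      _ = _ := by
          simp only [sq_abs]
          congr 1
          refine Finset.sum_congr rfl fun i _ => ?_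
          ring
  have lim := le_of_tendsto_of_tendsto ((hw'.tendsto_sum_nat.norm).pow 2)
    (hq'.tendsto_sum_nat.mul hgeo.tendsto_sum_nat) (Eventually.of_forall key)
  have hpos : 0 < 1 - ‖x‖ ^ 2 := by linarith
  calc ‖w‖ ^ 2 * (1 - ‖x‖ ^ 2) ≤ q * (‖x‖ ^ 2 * (1 - ‖x‖ ^ 2)⁻¹) * (1 - ‖x‖ ^ 2) := by gcongr
    _ = q * ‖x‖ ^ 2 := by field_simp

theorem tendsto_coeff_polynomial_mul (R : Polynomial ℂ) {u : PowerSeries ℂ}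
    (hu : Tendsto (fun n => PowerSeries.coeff n u) atTop (𝓝 0)) :
    Tendsto (fun n => PowerSeries.coeff n ((R : PowerSeries ℂ) * u)) atTop (𝓝 0) := by
  induction R using Polynomial.induction_on' with
  | add p q hp hq => simpa [add_mul] using hp.add hq
  | monomial k a =>
    rw [Polynomial.coe_monomial]
    have e : PowerSeries.monomial k a * u = PowerSeries.C a * (PowerSeries.X ^ k * u) := by
      rw [← mul_assoc, PowerSeries.monomial_eq_C_mul_X_pow]
    rw [e, ← tendsto_add_atTop_iff_nat k]
    simpa using hu.const_mul a

end Gain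

/-! ### Gains for one real root and for a root pair -/

section IsGain

open Polynomial

/-- `g` is the impulse response of a strictly causal filter of energy `q` that, applied after the
whitening filter `l`, predicts every solution of `v (n + 2) = a * v (n + 1) + b * v n` up to an error
tending to `0`. -/
structure IsGain (l : ℝ[X]) (a b q : ℝ) (g : PowerSeries ℝ) : Prop where
  coeff_zero : PowerSeries.coeff 0 g = 0
  tendsto_coeff : Tendsto (fun n => PowerSeries.coeff n g) atTop (𝓝 0)
  hasSum : HasSum (fun n => PowerSeries.coeff n g ^ 2) q
  exists_quotient : ∃ r : PowerSeries ℝ, Tendsto (fun n => PowerSeries.coeff n r) atTop (𝓝 0) ∧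
    1 - g * (l : PowerSeries ℝ) =
      (1 - PowerSeries.C a * PowerSeries.X - PowerSeries.C b * PowerSeries.X ^ 2) * r

/-- The quotient is formed over ℝ by formal division by the unstable quadratic 1 - aX - bX². Over ℂ
it equals R/(1 - sX + mX²): the unstable zeros have cancelled, and a polynomial times a stable
impulse response has coefficients tending to 0. -/
theorem isGain_gainSeries {l : ℝ[X]} {s m A B a b q : ℝ} {x₁ x₂ : ℂ} (hs : x₁ + x₂ = s)
    (hm : x₁ * x₂ = m) (h1 : ‖x₁‖ < 1) (h2 : ‖x₂‖ < 1)
    (hq : HasSum (fun n => PowerSeries.coeff n (gainSeries s m A B) ^ 2) q) (R : ℂ[X])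
    (hR : 1 - C (s : ℂ) * X + C (m : ℂ) * X ^ 2 -
        (C (A : ℂ) * X + C (B : ℂ) * X ^ 2) * l.map Complex.ofRealHom =
      (1 - C (a : ℂ) * X - C (b : ℂ) * X ^ 2) * R) :
    IsGain l a b q (gainSeries s m A B) := by
  refine ⟨coeff_gainSeries_zero, tendsto_coeff_gainSeries hs hm h1 h2, hq,
    (1 - gainSeries s m A B * l) * PowerSeries.mk (impulse a (-b)), ?_, ?_⟩
  · set φ := PowerSeries.map Complex.ofRealHom with hφ
    have hU := congrArg φ (mk_impulse_mul s m)
    have hV := congrArg φ (mk_impulse_mul a (-b))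
    have hR' := congrArg (fun P : ℂ[X] => (P : PowerSeries ℂ)) hR
    simp only [coe_sub, coe_add, coe_mul, coe_one, coe_C, coe_X, coe_pow] at hR'
    have hl : φ (l : PowerSeries ℝ) = ((l.map Complex.ofRealHom : ℂ[X]) : PowerSeries ℂ) := by
      ext n
      simp [hφ]
    have key : φ ((1 - gainSeries s m A B * l) * PowerSeries.mk (impulse a (-b))) =
        (R : PowerSeries ℂ) * φ (PowerSeries.mk (impulse s m)) := by
      rw [gainSeries]
      simp only [map_mul, map_sub, map_one, map_add, map_pow, hl]
      simp only [map_mul, map_sub, map_one, map_add, map_pow, map_neg, hφ, PowerSeries.map_C,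
        PowerSeries.map_X, Complex.ofRealHom_eq_coe] at hU hV ⊢
      set U := PowerSeries.map Complex.ofRealHom (PowerSeries.mk (impulse s m))
      set V := PowerSeries.map Complex.ofRealHom (PowerSeries.mk (impulse a (-b)))
      linear_combination (-V) * hU + V * U * hR' + U * (R : PowerSeries ℂ) * hV
    have hu : Tendsto (fun n => PowerSeries.coeff n (φ (PowerSeries.mk (impulse s m)))) atTop
        (𝓝 0) := by
      have := (summable_abs_impulse hs hm h1 h2).of_abs.tendsto_atTop_zero
      have h' := (Complex.continuous_ofReal.tendsto 0).comp this
      simpa [hφ, Function.comp_def] using h'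
    have h' := tendsto_coeff_polynomial_mul R hu
    rw [← key] at h'
    have e : ∀ (F : PowerSeries ℝ) n, PowerSeries.coeff n (φ F) = ((PowerSeries.coeff n F : ℝ) : ℂ) :=
      fun F n => by rw [hφ, PowerSeries.coeff_map]; rfl
    have h'' := (Complex.continuous_re.tendsto 0).comp h'
    simpa only [Function.comp_def, e, Complex.ofReal_re, Complex.zero_re] using h''
  · have := mk_impulse_mul a (-b)
    simp only [map_neg] at this
    linear_combination (-(1 - gainSeries s m A B * (l : PowerSeries ℝ))) * this

theorem norm_inv_lt_one {γ : ℂ} (h : 1 < ‖γ‖) : ‖γ⁻¹‖ < 1 := by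
  rw [norm_inv]; exact inv_lt_one_of_one_lt₀ h

theorem ne_zero_of_one_lt_norm {γ : ℂ} (h : 1 < ‖γ‖) : γ ≠ 0 := by
  rintro rfl; simp at h; linarith

/-- Here the second node is 0, so g = AX/(1 - γ⁻¹X). The condition g(γ⁻¹) = 1/l(γ⁻¹) forces A = (γ²
- 1)/(γ l(γ⁻¹)), with energy A²/(1 - γ⁻²) = (γ² - 1)/l(γ⁻¹)². -/
theorem exists_isGain_of_real {l : ℝ[X]} (hl : ∀ z : ℂ, ‖z‖ ≤ 1 → (l.map Complex.ofRealHom).eval z ≠ 0)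
    {γ : ℝ} (hγ : 1 < |γ|) {q : ℝ}
    (hq : ((γ : ℂ) ^ 2 - 1) * (1 / (l.map Complex.ofRealHom).eval (γ : ℂ)⁻¹) ^ 2 = q) :
    ∃ g, IsGain l γ 0 q g := by
  have hγ' : 1 < ‖(γ : ℂ)‖ := by simpa using hγ
  have h0 := ne_zero_of_one_lt_norm hγ'
  have hx := norm_inv_lt_one hγ'
  set L := l.map Complex.ofRealHom with hL
  have hLx := hl _ hx.le
  have hev : L.eval (γ : ℂ)⁻¹ = ((l.eval γ⁻¹ : ℝ) : ℂ) := by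
    rw [hL, ← Complex.ofReal_inv]
    exact Polynomial.eval_map_apply Complex.ofRealHom γ⁻¹
  have hlx : l.eval γ⁻¹ ≠ 0 := by
    intro h; rw [hev, h] at hLx; exact hLx Complex.ofReal_zero
  have hγ0 : γ ≠ 0 := by rintro rfl; simp at hγ; linarith
  have hs : (γ : ℂ)⁻¹ + 0 = ((γ⁻¹ : ℝ) : ℂ) := by simp
  have hm : (γ : ℂ)⁻¹ * 0 = ((0 : ℝ) : ℂ) := by simp
  obtain ⟨q', hq', hq2⟩ := hasSum_gainSeries_sq (A := (γ ^ 2 - 1) / (γ * l.eval γ⁻¹)) (B := 0)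
    hs hm hx (by simp)
  have hqq : q' = q := by
    rw [hev] at hq
    have e1 : q' * (1 - γ⁻¹ ^ 2) = ((γ ^ 2 - 1) / (γ * l.eval γ⁻¹)) ^ 2 := by
      have : ((q' * (1 - γ⁻¹ ^ 2) : ℝ) : ℂ) =
          (((γ ^ 2 - 1) / (γ * l.eval γ⁻¹)) ^ 2 : ℝ) := by
        push_cast
        push_cast at hq2
        simpa using hq2
      exact_mod_cast this
    have e2 : (γ ^ 2 - 1) * (1 / l.eval γ⁻¹) ^ 2 = q := by exact_mod_cast hq
    have hγ1 : γ ^ 2 - 1 ≠ 0 := by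
      have := one_lt_sq_iff_one_lt_abs γ |>.2 hγ
      linarith
    rw [← e2]
    have e3 : (1 - γ⁻¹ ^ 2) = (γ ^ 2 - 1) / γ ^ 2 := by field_simp
    have e4 : q' = ((γ ^ 2 - 1) / (γ * l.eval γ⁻¹)) ^ 2 / (1 - γ⁻¹ ^ 2) := by
      rw [eq_div_iff, e1]
      rw [e3]; positivity
    rw [e4, e3]
    field_simp
  subst hqq
  obtain ⟨M, hM⟩ := (dvd_iff_isRoot (p := L - C (L.eval (γ : ℂ)⁻¹)) (a := (γ : ℂ)⁻¹)).2 (by simp)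
  refine ⟨_, isGain_gainSeries hs hm hx (by simp) hq'
    (1 + C ((((γ ^ 2 - 1) / (γ * l.eval γ⁻¹) : ℝ) : ℂ) * (γ : ℂ)⁻¹) * X * M) ?_⟩
  rw [← hL]
  have hM' : L = C (L.eval (γ : ℂ)⁻¹) + (X - C (γ : ℂ)⁻¹) * M := by rw [← hM]; ring
  conv_lhs => rw [hM', hev]
  set α := (γ ^ 2 - 1) / (γ * l.eval γ⁻¹) with hα
  have hαl : γ⁻¹ + α * l.eval γ⁻¹ = γ := by
    rw [hα]
    generalize l.eval γ⁻¹ = y at *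
    field_simp
    ring
  have c1 : (C (γ : ℂ)⁻¹ + C (α : ℂ) * C ((l.eval γ⁻¹ : ℝ) : ℂ) : ℂ[X]) = C (γ : ℂ) := by
    rw [← C_mul, ← C_add]; congr 1; exact_mod_cast hαl
  have c4 : (C (γ : ℂ) * C (γ : ℂ)⁻¹ : ℂ[X]) = 1 := by rw [← C_mul, mul_inv_cancel₀ h0, C_1]
  clear_value α
  simp only [C_mul, Complex.ofReal_zero, C_0, Complex.ofReal_inv]
  linear_combination (-X) * c1 + C (α : ℂ) * X ^ 2 * M * c4

theorem conj_gainSlope {L : ℂ[X]} (hL : ∀ m, (L.coeff m).im = 0) (γ₁ γ₂ : ℂ) :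
    (starRingEnd ℂ) (gainSlope L γ₁ γ₂) =
      gainSlope L ((starRingEnd ℂ) γ₁) ((starRingEnd ℂ) γ₂) := by
  simp only [gainSlope, map_add, map_mul, map_div₀, map_sub, map_pow, map_one, map_inv₀,
    conj_divDiff hL, conj_eval hL]

theorem conj_gainIntercept {L : ℂ[X]} (hL : ∀ m, (L.coeff m).im = 0) (γ₁ γ₂ : ℂ) :
    (starRingEnd ℂ) (gainIntercept L γ₁ γ₂) =
      gainIntercept L ((starRingEnd ℂ) γ₁) ((starRingEnd ℂ) γ₂) := by
  simp only [gainIntercept, gainNum, map_mul, map_div₀, map_sub, map_pow, map_one, map_inv₀,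
    conj_gainSlope hL, conj_eval hL]

theorem conj_roots {γ₁ γ₂ : ℂ} {a b : ℝ} (ha : γ₁ + γ₂ = a) (hb : γ₁ * γ₂ = -b) :
    ((starRingEnd ℂ) γ₁ = γ₁ ∧ (starRingEnd ℂ) γ₂ = γ₂) ∨
      ((starRingEnd ℂ) γ₁ = γ₂ ∧ (starRingEnd ℂ) γ₂ = γ₁) := by
  have ha' := congrArg (starRingEnd ℂ) ha
  have hb' := congrArg (starRingEnd ℂ) hb
  simp only [map_add, map_mul, map_neg, Complex.conj_ofReal] at ha' hb'
  have h : ((starRingEnd ℂ) γ₁ - γ₁) * ((starRingEnd ℂ) γ₁ - γ₂) = 0 := by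
    linear_combination (-(starRingEnd ℂ) γ₁) * (ha - ha') + (hb - hb')
  rcases mul_eq_zero.1 h with h | h
  · left
    have h := sub_eq_zero.1 h
    exact ⟨h, by linear_combination ha' - ha - h⟩
  · right
    have h := sub_eq_zero.1 h
    exact ⟨h, by linear_combination ha' - ha - h⟩

/-- Slope and intercept are symmetric in the roots, and conjugation fixes or swaps the roots, so the
filter coefficients are real. The final inequality is Cauchy-Schwarz for the value g(γ₁⁻¹) =
1/L(γ₁⁻¹); it keeps the roots bounded when the maximum is taken. -/
theorem exists_isGain {l : ℝ[X]} (hl : ∀ z : ℂ, ‖z‖ ≤ 1 → (l.map Complex.ofRealHom).eval z ≠ 0)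
    {γ₁ γ₂ : ℂ} (hγ₁ : 1 < ‖γ₁‖) (hγ₂ : 1 < ‖γ₂‖) {a b : ℝ} (ha : γ₁ + γ₂ = a)
    (hb : γ₁ * γ₂ = -b) :
    ∃ (q : ℝ) (g : PowerSeries ℝ), IsGain l a b q g ∧
      powerForm (l.map Complex.ofRealHom) γ₁ γ₂ = q ∧
      ‖γ₁‖ ^ 2 - 1 ≤ q * ‖(l.map Complex.ofRealHom).eval γ₁⁻¹‖ ^ 2 := by
  set L := l.map Complex.ofRealHom with hL
  have hLr : ∀ m, (L.coeff m).im = 0 := fun m => by simp [hL]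
  have h1 := ne_zero_of_one_lt_norm hγ₁
  have h2 := ne_zero_of_one_lt_norm hγ₂
  have hx1 := norm_inv_lt_one hγ₁
  have hx2 := norm_inv_lt_one hγ₂
  have hL1 := hl _ hx1.le
  have hL2 := hl _ hx2.le
  have hm : γ₁⁻¹ * γ₂⁻¹ = ((-b)⁻¹ : ℝ) := by rw [← mul_inv, hb]; push_cast; rfl
  have hs : γ₁⁻¹ + γ₂⁻¹ = (a * (-b)⁻¹ : ℝ) := by
    rw [Complex.ofReal_mul, ← ha, ← hm]; field_simp; ring
  have hδ : ∃ δ : ℝ, gainSlope L γ₁ γ₂ = δ := by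
    refine ⟨_, (Complex.conj_eq_iff_re.1 ?_).symm⟩
    rw [conj_gainSlope hLr]
    rcases conj_roots ha hb with ⟨e1, e2⟩ | ⟨e1, e2⟩
    · rw [e1, e2]
    · rw [e1, e2, gainSlope_comm h1 h2 hL1 hL2]
  have hι : ∃ ι : ℝ, gainIntercept L γ₁ γ₂ = ι := by
    refine ⟨_, (Complex.conj_eq_iff_re.1 ?_).symm⟩
    rw [conj_gainIntercept hLr]
    rcases conj_roots ha hb with ⟨e1, e2⟩ | ⟨e1, e2⟩
    · rw [e1, e2]
    · rw [e1, e2, gainIntercept_comm h1 h2 hL1 hL2]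
  obtain ⟨δ, hδ⟩ := hδ
  obtain ⟨ι, hι⟩ := hι
  obtain ⟨R, hR⟩ := exists_interpolation_quotient h1 h2 hL1 hL2
  -- Here (-b)⁻¹ = γ₁⁻¹γ₂⁻¹, so A and B are the coefficients in `exists_interpolation_quotient`.
  obtain ⟨q, hq, hq2⟩ := hasSum_gainSeries_sq (A := (1 - (-b)⁻¹) * δ) (B := (1 - (-b)⁻¹) * ι)
    hs hm hx1 hx2
  have n12 := one_sub_mul_ne_zero hx1 hx2
  have n11 : 1 - γ₁⁻¹ ^ 2 ≠ 0 := by rw [sq]; exact one_sub_mul_ne_zero hx1 hx1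
  have n22 : 1 - γ₂⁻¹ ^ 2 ≠ 0 := by rw [sq]; exact one_sub_mul_ne_zero hx2 hx2
  refine ⟨q, _, isGain_gainSeries hs hm hx1 hx2 hq R ?_, ?_, ?_⟩
  · rw [hδ, hι, ha, hb, hs, hm] at hR
    rw [← hL]
    push_cast at hR ⊢
    rw [hR, C_neg]
    ring
  · rw [powerForm, div_eq_iff (mul_ne_zero n11 n22), hδ, hι]
    apply mul_left_cancel₀ n12
    push_cast at hq2
    push_cast at hm
    rw [← hm] at hq2
    linear_combination (-1) * hq2
  · have hw := hasSum_gainSeries_mul_pow (A := (1 - (-b)⁻¹) * δ) (B := (1 - (-b)⁻¹) * ι)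
      hs hm hx1 hx2
    have hval : ((((1 - (-b)⁻¹) * δ : ℝ) : ℂ) * γ₁⁻¹ + (((1 - (-b)⁻¹) * ι : ℝ) : ℂ) * γ₁⁻¹ ^ 2) /
        ((1 - γ₁⁻¹ ^ 2) * (1 - γ₁⁻¹ * γ₂⁻¹)) = (L.eval γ₁⁻¹)⁻¹ := by
      have e : (((1 - (-b)⁻¹ : ℝ)) : ℂ) = 1 - γ₁⁻¹ * γ₂⁻¹ := by rw [hm]; push_cast; rfl
      have hf : (δ : ℂ) * γ₁ + ι = gainNum L γ₁ := by rw [← hδ, ← hι, gainIntercept]; ring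
      have hf' : (δ : ℂ) * γ₁⁻¹ + ι * γ₁⁻¹ ^ 2 = (1 - γ₁⁻¹ ^ 2) * (L.eval γ₁⁻¹)⁻¹ := by
        have : (δ : ℂ) * γ₁⁻¹ + ι * γ₁⁻¹ ^ 2 = γ₁⁻¹ ^ 2 * ((δ : ℂ) * γ₁ + ι) := by field_simp
        rw [this, hf, gainNum, div_eq_mul_inv, ← mul_assoc]
        congr 1
        field_simp
      rw [Complex.ofReal_mul, Complex.ofReal_mul, e, div_eq_iff (mul_ne_zero n11 n12)]
      linear_combination (1 - γ₁⁻¹ * γ₂⁻¹) * hf'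
    rw [hval] at hw
    have hcs := norm_sq_le_of_hasSum coeff_gainSeries_zero hq hx1 hw
    have p1 : 0 < ‖γ₁‖ := by linarith
    have p2 : 0 < ‖L.eval γ₁⁻¹‖ := norm_pos_iff.2 hL1
    rw [norm_inv, norm_inv] at hcs
    generalize ‖L.eval γ₁⁻¹‖ = y at *
    generalize ‖γ₁‖ = x at *
    have := mul_le_mul_of_nonneg_left hcs (by positivity : 0 ≤ x ^ 2 * y ^ 2)
    calc x ^ 2 - 1 = x ^ 2 * y ^ 2 * (y⁻¹ ^ 2 * (1 - x⁻¹ ^ 2)) := by field_simp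
      _ ≤ _ := this
      _ = q * y ^ 2 := by field_simp

end IsGain

/-! ### Existence of the two maxima -/

section ClosedForm

open Polynomial

variable {p : ℕ} {β : Fin p → ℂ}

theorem LZ_ne_zero (hβ : ∀ k, ‖β k‖ < 1) {z : ℂ} (hz : ‖z‖ ≤ 1) : (arPoly β).eval z ≠ 0 := by
  rw [arPoly, eval_prod, Finset.prod_ne_zero_iff]
  intro k _ h
  simp only [eval_add, eval_one, eval_mul, eval_C, eval_X] at h
  have h1 : ‖β k * z‖ = 1 := by
    rw [← norm_neg, ← eq_neg_of_add_eq_zero_left h, norm_one]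
  rw [norm_mul] at h1
  nlinarith [hβ k, norm_nonneg (β k), norm_nonneg z]

theorem exists_real_arPoly (hreal : ∀ m, ((arPoly β).coeff m).im = 0) :
    ∃ l : ℝ[X], l.map Complex.ofRealHom = arPoly β := by
  refine (mem_lifts _).1 ((lifts_iff_coeff_lifts _).2 fun m => ?_)
  exact ⟨((arPoly β).coeff m).re, Complex.ext (by simp) (by simp [hreal m])⟩

theorem exists_norm_eval_le (L : ℂ[X]) :
    ∃ K : ℝ, 0 < K ∧ ∀ z : ℂ, ‖z‖ ≤ 1 → ‖L.eval z‖ ≤ K := by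
  obtain ⟨K, hK⟩ := (isCompact_closedBall (0 : ℂ) 1).exists_bound_of_continuousOn
    (f := fun z => L.eval z) L.continuous.continuousOn
  exact ⟨max K 1, by positivity, fun z hz => (hK z (by simpa using hz)).trans (le_max_left _ _)⟩

/-- The constraint is a closed condition on |γ| ≥ 1. Points with |γ| = 1 never satisfy it, since
there f = -P l(γ⁻¹)² < 0, so maximizing over the closed region loses nothing. -/
theorem exists_isGreatest_sk1Rates (hβ : ∀ k, ‖β k‖ < 1)
    (hreal : ∀ m, ((arPoly β).coeff m).im = 0) {P : ℝ} (hP : 0 < P) :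
    ∃ I, IsGreatest (sk1Rates β P) I := by
  obtain ⟨l, hl⟩ := exists_real_arPoly hreal
  obtain ⟨K, hK0, hK⟩ := exists_norm_eval_le (arPoly β)
  have hev : ∀ γ : ℝ, (arPoly β).eval (γ : ℂ)⁻¹ = ((l.eval γ⁻¹ : ℝ) : ℂ) := fun γ => by
    rw [← hl, ← Complex.ofReal_inv]
    exact eval_map_apply Complex.ofRealHom γ⁻¹
  have hinv : ∀ γ : ℝ, 1 ≤ |γ| → ‖(γ : ℂ)⁻¹‖ ≤ 1 := fun γ h => by
    rw [norm_inv, Complex.norm_real]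
    exact inv_le_one_of_one_le₀ h
  have hne : ∀ γ : ℝ, 1 ≤ |γ| → l.eval γ⁻¹ ≠ 0 := fun γ h h0 => by
    have := LZ_ne_zero hβ (hinv γ h)
    rw [hev, h0] at this
    exact this Complex.ofReal_zero
  have hle : ∀ γ : ℝ, 1 ≤ |γ| → l.eval γ⁻¹ ^ 2 ≤ K ^ 2 := fun γ h => by
    have := hK _ (hinv γ h)
    rw [hev, Complex.norm_real, Real.norm_eq_abs] at this
    exact sq_le_sq' (by linarith [neg_abs_le (l.eval γ⁻¹)]) ((le_abs_self _).trans this)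
  have hiff : ∀ γ : ℝ, 1 ≤ |γ| → (((γ : ℂ) ^ 2 - 1) * HZ β ((γ : ℂ)⁻¹) ^ 2 = (P : ℂ) ↔
      γ ^ 2 - 1 - P * l.eval γ⁻¹ ^ 2 = 0) := fun γ h => by
    have h0 := hne γ h
    rw [HZ, LZ, hev]
    have : ((γ : ℂ) ^ 2 - 1) * (1 / ((l.eval γ⁻¹ : ℝ) : ℂ)) ^ 2 =
      (((γ ^ 2 - 1) * (1 / l.eval γ⁻¹) ^ 2 : ℝ) : ℂ) := by push_cast; rfl
    rw [this, Complex.ofReal_inj]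
    generalize l.eval γ⁻¹ = y at *
    field_simp
    rw [sub_eq_zero, mul_comm]
  -- At B, f is at least B² - B > 0, which gives the intermediate value; any zero has γ² ≤ B, hence
  -- |γ| ≤ B.
  set B := 1 + P * K ^ 2 with hB
  have hB1 : 1 < B := by rw [hB]; have := mul_pos hP (pow_pos hK0 2); linarith
  set f : ℝ → ℝ := fun γ => γ ^ 2 - 1 - P * l.eval γ⁻¹ ^ 2 with hf
  have hclosed : IsClosed {γ : ℝ | 1 ≤ |γ|} := isClosed_le continuous_const continuous_abs
  have hcont : ContinuousOn f {γ : ℝ | 1 ≤ |γ|} := by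
    have hi : ContinuousOn (fun γ : ℝ => γ⁻¹) {γ : ℝ | 1 ≤ |γ|} :=
      continuousOn_id.inv₀ fun γ (h : 1 ≤ |γ|) h0 => by
        simp only [id] at h0; rw [h0, abs_zero] at h; linarith
    have := l.continuous.comp_continuousOn hi
    simp only [hf]
    fun_prop
  obtain ⟨γ₀, hγ₀, hfγ₀⟩ : ∃ γ ∈ Set.Icc 1 B, f γ = 0 := by
    have := intermediate_value_Icc hB1.le (hcont.mono fun γ hγ => hγ.1.trans (le_abs_self _))
    refine this ⟨?_, ?_⟩
    · have : 0 ≤ P * l.eval (1 : ℝ)⁻¹ ^ 2 := by positivity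
      simp only [hf]; linarith
    · have := hle B (hB1.le.trans (le_abs_self _))
      have h2 := mul_le_mul_of_nonneg_left this hP.le
      simp only [hf]
      nlinarith
  have hT : IsCompact {γ : ℝ | 1 ≤ |γ| ∧ f γ = 0} := by
    refine Metric.isCompact_of_isClosed_isBounded
      (hcont.preimage_isClosed_of_isClosed hclosed isClosed_singleton)
      ((Metric.isBounded_closedBall (x := (0 : ℝ)) (r := B)).subset ?_)
    rintro γ ⟨h1, h2⟩
    rw [mem_closedBall_zero_iff, Real.norm_eq_abs]
    have := mul_le_mul_of_nonneg_left (hle γ h1) hP.le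
    simp only [hf] at h2
    rw [← sq_abs] at h2
    nlinarith
  obtain ⟨γ, ⟨hγ1, hγ2⟩, hmax⟩ := hT.exists_isMaxOn
    ⟨γ₀, hγ₀.1.trans (le_abs_self _), hfγ₀⟩ continuous_abs.continuousOn
  have hlt : 1 < |γ| := by
    refine lt_of_le_of_ne hγ1 fun h => ?_
    have h0 := hne γ hγ1
    simp only [hf] at hγ2
    rw [← sq_abs, ← h] at hγ2
    have : 0 < P * l.eval γ⁻¹ ^ 2 := by positivity
    linarith
  refine ⟨Real.log |γ|, ⟨γ, hlt, (hiff γ hγ1).2 hγ2, rfl⟩, ?_⟩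
  rintro _ ⟨γ', h1, h2, rfl⟩
  exact Real.log_le_log (by linarith) (hmax ⟨h1.le, (hiff γ' h1.le).1 h2⟩)

theorem continuousOn_powerForm {L : ℂ[X]} (hL : ∀ z : ℂ, ‖z‖ ≤ 1 → L.eval z ≠ 0) :
    ContinuousOn (fun z : ℂ × ℂ => powerForm L z.1 z.2) {z | 1 < ‖z.1‖ ∧ 1 < ‖z.2‖} := by
  set S : Set (ℂ × ℂ) := {z | 1 < ‖z.1‖ ∧ 1 < ‖z.2‖} with hS
  have h1 : ∀ z ∈ S, 1 < ‖z.1‖ := fun z hz => hz.1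
  have h2 : ∀ z ∈ S, 1 < ‖z.2‖ := fun z hz => hz.2
  clear_value S
  have i1 : ContinuousOn (fun z : ℂ × ℂ => z.1⁻¹) S :=
    continuousOn_fst.inv₀ fun z hz => ne_zero_of_one_lt_norm (h1 z hz)
  have i2 : ContinuousOn (fun z : ℂ × ℂ => z.2⁻¹) S :=
    continuousOn_snd.inv₀ fun z hz => ne_zero_of_one_lt_norm (h2 z hz)
  have l1 : ContinuousOn (fun z : ℂ × ℂ => L.eval z.1⁻¹) S := L.continuous.comp_continuousOn i1
  have l2 : ContinuousOn (fun z : ℂ × ℂ => L.eval z.2⁻¹) S := L.continuous.comp_continuousOn i2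
  have d := (continuous_divDiff L).comp_continuousOn (i1.prodMk i2)
  simp only [Function.comp_def] at d
  have n1 : ∀ z ∈ S, L.eval z.1⁻¹ ≠ 0 := fun z hz => hL _ (norm_inv_lt_one (h1 z hz)).le
  have n2 : ∀ z ∈ S, L.eval z.2⁻¹ ≠ 0 := fun z hz => hL _ (norm_inv_lt_one (h2 z hz)).le
  have f1 : ContinuousOn (fun z : ℂ × ℂ => z.1) S := continuousOn_fst
  have f2 : ContinuousOn (fun z : ℂ × ℂ => z.2) S := continuousOn_snd
  have s : ContinuousOn (fun z : ℂ × ℂ => gainSlope L z.1 z.2) S := by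
    simp only [gainSlope]
    have e1 := (f1.add f2).div l1 n1
    have e2 := ((((f2.pow 2).sub (continuousOn_const (c := (1 : ℂ)))).mul i1).mul i2).mul d
    have e3 := e2.div (l1.mul l2) fun z hz => mul_ne_zero (n1 z hz) (n2 z hz)
    exact e1.add e3
  have t : ContinuousOn (fun z : ℂ × ℂ => gainIntercept L z.1 z.2) S := by
    simp only [gainIntercept, gainNum]
    have e1 := ((f1.pow 2).sub (continuousOn_const (c := (1 : ℂ)))).div l1 n1
    exact e1.sub (s.mul f1)
  have c1 : ContinuousOn (fun _ : ℂ × ℂ => (1 : ℂ)) S := continuousOn_const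
  have c2 : ContinuousOn (fun _ : ℂ × ℂ => (2 : ℂ)) S := continuousOn_const
  have num := (c1.sub (i1.mul i2)).mul (((c1.add (i1.mul i2)).mul
      ((s.pow 2).add (t.pow 2))).add (((c2.mul (i1.add i2)).mul s).mul t))
  have den := (c1.sub (i1.pow 2)).mul (c1.sub (i2.pow 2))
  simp only [powerForm]
  refine num.div den fun z hz => mul_ne_zero ?_ ?_
  · rw [sq]; exact one_sub_mul_ne_zero (norm_inv_lt_one (h1 z hz)) (norm_inv_lt_one (h1 z hz))
  · rw [sq]; exact one_sub_mul_ne_zero (norm_inv_lt_one (h2 z hz)) (norm_inv_lt_one (h2 z hz))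

theorem powerExpr_eq_powerForm_of_norm (hβ : ∀ k, ‖β k‖ < 1) {γ₁ γ₂ : ℂ} (h1 : 1 < ‖γ₁‖)
    (h2 : 1 < ‖γ₂‖) (hne : γ₁ ≠ γ₂) : powerExpr β γ₁ γ₂ = powerForm (arPoly β) γ₁ γ₂ := by
  have key : ∀ {x y : ℂ}, 1 < ‖x‖ → 1 < ‖y‖ → x * y - 1 ≠ 0 := fun {x y} hx hy h => by
    have h4 : ‖x‖ * ‖y‖ = 1 := by rw [← norm_mul, sub_eq_zero.1 h, norm_one]
    nlinarith
  exact powerExpr_eq_powerForm β (ne_zero_of_one_lt_norm h1) (ne_zero_of_one_lt_norm h2) hne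
    (by rw [sq]; exact key h1 h1) (by rw [sq]; exact key h2 h2) (key h1 h2)
    (LZ_ne_zero hβ (norm_inv_lt_one h1).le) (LZ_ne_zero hβ (norm_inv_lt_one h2).le)

/-- Continuity of `powerForm` identifies the limit that defines the double-root branch, so both
branches become one condition. -/
theorem powerConstraint_iff (hβ : ∀ k, ‖β k‖ < 1) {γ₁ γ₂ : ℂ} (h1 : 1 < ‖γ₁‖)
    (h2 : 1 < ‖γ₂‖) {P : ℝ} :
    PowerConstraint β P γ₁ γ₂ ↔ ∃ q : ℝ, q ≤ P ∧ powerForm (arPoly β) γ₁ γ₂ = q := by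
  rw [PowerConstraint]
  by_cases hne : γ₁ = γ₂
  · subst hne
    have hopen : IsOpen {z : ℂ | 1 < ‖z‖} := isOpen_lt continuous_const continuous_norm
    have hlim : Tendsto (fun z => powerExpr β z γ₁) (𝓝[≠] γ₁)
        (𝓝 (powerForm (arPoly β) γ₁ γ₁)) := by
      have hmem : {z : ℂ × ℂ | 1 < ‖z.1‖ ∧ 1 < ‖z.2‖} ∈ 𝓝 (γ₁, γ₁) :=
        ((hopen.preimage continuous_fst).inter (hopen.preimage continuous_snd)).mem_nhds ⟨h1, h1⟩
      have hc := (continuousOn_powerForm fun z hz => LZ_ne_zero hβ hz).continuousAt hmem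
      have hp : Tendsto (fun z : ℂ => (z, γ₁)) (𝓝 γ₁) (𝓝 (γ₁, γ₁)) :=
        (Continuous.prodMk_left γ₁).tendsto γ₁
      have hc' := hc.tendsto.comp hp
      simp only [Function.comp_def] at hc'
      refine (hc'.mono_left nhdsWithin_le_nhds).congr' ?_
      filter_upwards [self_mem_nhdsWithin, nhdsWithin_le_nhds (hopen.mem_nhds h1)] with z hz hz1
      exact (powerExpr_eq_powerForm_of_norm hβ hz1 h1 hz).symm
    simp only [ne_eq, not_true_eq_false, false_and, true_and, false_or]
    refine exists_congr fun q => and_congr_right fun _ => ⟨fun h => ?_, fun h => ?_⟩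
    · exact tendsto_nhds_unique hlim h
    · rwa [h] at hlim
  · simp [hne, powerExpr_eq_powerForm_of_norm hβ h1 h2 hne]

/-- For opposite roots the cross term vanishes. Slope and intercept each carry a factor γ² - 1, and
only one of the two in their squares is cancelled by the denominator, so the form vanishes as γ
tends to 1. -/
theorem powerForm_neg_self {L : ℂ[X]} {γ : ℂ} (h0 : γ ≠ 0) (h1 : γ ^ 2 - 1 ≠ 0) :
    powerForm L γ (-γ) = (1 + γ⁻¹ ^ 2) * (γ ^ 2 - 1) * γ ^ 2 *
      ((γ⁻¹ ^ 2 * divDiff L γ⁻¹ (-γ⁻¹) / (L.eval γ⁻¹ * L.eval (-γ⁻¹))) ^ 2 +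
        (1 / L.eval γ⁻¹ + γ⁻¹ * divDiff L γ⁻¹ (-γ⁻¹) / (L.eval γ⁻¹ * L.eval (-γ⁻¹))) ^ 2) := by
  have hs : gainSlope L γ (-γ) =
      -((γ ^ 2 - 1) * (γ⁻¹ ^ 2 * divDiff L γ⁻¹ (-γ⁻¹) / (L.eval γ⁻¹ * L.eval (-γ⁻¹)))) := by
    rw [gainSlope, inv_neg]; ring
  have hi : gainIntercept L γ (-γ) = (γ ^ 2 - 1) *
      (1 / L.eval γ⁻¹ + γ⁻¹ * divDiff L γ⁻¹ (-γ⁻¹) / (L.eval γ⁻¹ * L.eval (-γ⁻¹))) := by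
    rw [gainIntercept, gainNum, hs]
    have : γ⁻¹ ^ 2 * γ = γ⁻¹ := by field_simp
    linear_combination (γ ^ 2 - 1) * (divDiff L γ⁻¹ (-γ⁻¹) / (L.eval γ⁻¹ * L.eval (-γ⁻¹))) * this
  rw [powerForm, hs, hi, inv_neg]
  generalize γ⁻¹ ^ 2 * divDiff L γ⁻¹ (-γ⁻¹) / (L.eval γ⁻¹ * L.eval (-γ⁻¹)) = u
  generalize 1 / L.eval γ⁻¹ + γ⁻¹ * divDiff L γ⁻¹ (-γ⁻¹) / (L.eval γ⁻¹ * L.eval (-γ⁻¹)) = v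
  have e : 1 - γ⁻¹ ^ 2 = (γ ^ 2 - 1) / γ ^ 2 := by field_simp
  rw [neg_sq, e]
  field_simp
  ring

theorem exists_powerForm_le {L : ℂ[X]} (hL : ∀ z : ℂ, ‖z‖ ≤ 1 → L.eval z ≠ 0) {P : ℝ}
    (hP : 0 < P) : ∃ γ : ℝ, 1 < γ ∧ ‖powerForm L γ (-γ)‖ < P := by
  set F : ℝ → ℂ := fun γ => (1 + (γ : ℂ)⁻¹ ^ 2) * ((γ : ℂ) ^ 2 - 1) * (γ : ℂ) ^ 2 *
      (((γ : ℂ)⁻¹ ^ 2 * divDiff L (γ : ℂ)⁻¹ (-(γ : ℂ)⁻¹) /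
          (L.eval (γ : ℂ)⁻¹ * L.eval (-(γ : ℂ)⁻¹))) ^ 2 +
        (1 / L.eval (γ : ℂ)⁻¹ + (γ : ℂ)⁻¹ * divDiff L (γ : ℂ)⁻¹ (-(γ : ℂ)⁻¹) /
          (L.eval (γ : ℂ)⁻¹ * L.eval (-(γ : ℂ)⁻¹))) ^ 2) with hF
  have hF1 : F 1 = 0 := by simp [hF]
  have hc : ContinuousAt F 1 := by
    have i : ContinuousAt (fun γ : ℝ => (γ : ℂ)⁻¹) 1 :=
      Complex.continuous_ofReal.continuousAt.inv₀ (by simp)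
    have o : ContinuousAt (fun γ : ℝ => (γ : ℂ)) 1 := Complex.continuous_ofReal.continuousAt
    have l1 : ContinuousAt (fun γ : ℝ => L.eval (γ : ℂ)⁻¹) 1 :=
      ContinuousAt.comp (g := fun z => L.eval z) L.continuous.continuousAt i
    have l2 : ContinuousAt (fun γ : ℝ => L.eval (-(γ : ℂ)⁻¹)) 1 :=
      ContinuousAt.comp (g := fun z => L.eval z) L.continuous.continuousAt i.neg
    have d := ContinuousAt.comp (g := fun z : ℂ × ℂ => divDiff L z.1 z.2)
        (continuous_divDiff L).continuousAt (i.prodMk i.neg)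
    simp only [Function.comp_def] at d
    have n1 : L.eval ((1 : ℝ) : ℂ)⁻¹ ≠ 0 := hL _ (by simp)
    have n2 : L.eval (-((1 : ℝ) : ℂ)⁻¹) ≠ 0 := hL _ (by simp)
    have n12 := mul_ne_zero n1 n2
    have q1 := ContinuousAt.div ((i.pow 2).mul d) (l1.mul l2) n12
    have q2 := ContinuousAt.div (i.mul d) (l1.mul l2) n12
    have q3 := ContinuousAt.div continuousAt_const l1 n1 (f := fun _ : ℝ => (1 : ℂ))
    exact (((continuousAt_const.add (i.pow 2)).mul ((o.pow 2).sub continuousAt_const)).mul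
      (o.pow 2)).mul ((q1.pow 2).add ((q3.add q2).pow 2))
  have hlt : ∀ᶠ γ in 𝓝 (1 : ℝ), ‖F γ‖ < P := by
    have := hc.norm.tendsto
    rw [hF1, norm_zero] at this
    exact this.eventually (gt_mem_nhds hP)
  have hlt' : ∀ᶠ γ in 𝓝[>] (1 : ℝ), ‖F γ‖ < P := nhdsWithin_le_nhds hlt
  obtain ⟨γ, hγ, h1⟩ := (hlt'.and self_mem_nhdsWithin).exists
  refine ⟨γ, h1, ?_⟩
  have h1 : 1 < γ := h1
  rwa [powerForm_neg_self]
  · exact_mod_cast (by linarith : γ ≠ 0)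
  · have : γ ^ 2 - 1 ≠ 0 := by nlinarith
    exact_mod_cast this

/-- The region |γᵢ| > 1 is not closed. One feasible pair (g₀, -g₀) repairs this: pairs with a root
of modulus below g₀ cannot beat it, and the remaining feasible pairs form a compact set. -/
theorem exists_isGreatest_sk2Rates (hβ : ∀ k, ‖β k‖ < 1)
    (hreal : ∀ m, ((arPoly β).coeff m).im = 0) {P : ℝ} (hP : 0 < P) :
    ∃ I, IsGreatest (sk2Rates β P) I := by
  obtain ⟨l, hl⟩ := exists_real_arPoly hreal
  obtain ⟨K, hK0, hK⟩ := exists_norm_eval_le (arPoly β)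
  have hLZ : ∀ z : ℂ, ‖z‖ ≤ 1 → (arPoly β).eval z ≠ 0 := fun z hz => LZ_ne_zero hβ hz
  -- The power is automatically real for such pairs and b ≠ 0 holds because the roots are nonzero,
  -- so only closed conditions remain besides |γᵢ| > 1.
  have hmem : ∀ r, r ∈ sk2Rates β P ↔ ∃ z : ℂ × ℂ, 1 < ‖z.1‖ ∧ 1 < ‖z.2‖ ∧ (z.1 + z.2).im = 0 ∧
      (z.1 * z.2).im = 0 ∧ (powerForm (arPoly β) z.1 z.2).re ≤ P ∧
      r = 2 * Real.log (min ‖z.1‖ ‖z.2‖) := by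
    intro r
    constructor
    · rintro ⟨a, b, γ₁, γ₂, _, hroots, h1, h2, hpow, rfl⟩
      obtain ⟨q, hq, hpq⟩ := (powerConstraint_iff hβ h1 h2).1 hpow
      have e0 := hroots 0
      have e1 := hroots 1
      have hs : γ₁ + γ₂ = a := by linear_combination e1 - e0
      have hb : γ₁ * γ₂ = -(b : ℂ) := by linear_combination -e0
      exact ⟨(γ₁, γ₂), h1, h2, by simp [hs], by simp [hb], by simpa [hpq] using hq, rfl⟩
    · rintro ⟨⟨γ₁, γ₂⟩, h1, h2, hs, hb, hq, rfl⟩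
      simp only at *
      have hs' : γ₁ + γ₂ = ((γ₁ + γ₂).re : ℂ) := Complex.ext (by simp) (by simpa using hs)
      have hb' : γ₁ * γ₂ = -((-(γ₁ * γ₂).re : ℝ) : ℂ) :=
        Complex.ext (by simp) (by simpa using hb)
      obtain ⟨q, _, _, hpq, _⟩ := exists_isGain (l := l) (by rwa [hl]) h1 h2 hs' hb'
      rw [hl] at hpq
      refine ⟨(γ₁ + γ₂).re, -(γ₁ * γ₂).re, γ₁, γ₂, ?_, fun x => ?_, h1, h2, (powerConstraint_iff hβ h1 h2).2
        ⟨q, by simpa [hpq] using hq, hpq⟩, rfl⟩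
      · intro h
        rw [h] at hb'
        simp only [Complex.ofReal_zero, neg_zero, mul_eq_zero] at hb'
        exact hb'.elim (ne_zero_of_one_lt_norm h1) (ne_zero_of_one_lt_norm h2)
      · rw [← hs']
        linear_combination -hb'
  -- By Cauchy-Schwarz, |γ₁|² - 1 ≤ q|L(γ₁⁻¹)|² ≤ PK².
  have hbound : ∀ z : ℂ × ℂ, 1 < ‖z.1‖ → 1 < ‖z.2‖ → (z.1 + z.2).im = 0 → (z.1 * z.2).im = 0 →
      (powerForm (arPoly β) z.1 z.2).re ≤ P → ‖z.1‖ ≤ 1 + P * K ^ 2 := by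
    rintro ⟨γ₁, γ₂⟩ h1 h2 hs hb hq
    simp only at *
    have hs' : γ₁ + γ₂ = ((γ₁ + γ₂).re : ℂ) := Complex.ext (by simp) (by simpa using hs)
    have hb' : γ₁ * γ₂ = -((-(γ₁ * γ₂).re : ℝ) : ℂ) :=
      Complex.ext (by simp) (by simpa using hb)
    obtain ⟨q, _, _, hpq, hle⟩ := exists_isGain (l := l) (by rwa [hl]) h1 h2 hs' hb'
    rw [hl] at hpq hle
    rw [hpq, Complex.ofReal_re] at hq
    have hy : ‖(arPoly β).eval γ₁⁻¹‖ ^ 2 ≤ K ^ 2 := by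
      gcongr; exact hK _ (norm_inv_lt_one h1).le
    have : q * ‖(arPoly β).eval γ₁⁻¹‖ ^ 2 ≤ P * K ^ 2 := by gcongr
    nlinarith
  obtain ⟨g₀, hg₀, hg₀P⟩ := exists_powerForm_le hLZ hP
  set T : Set (ℂ × ℂ) := {z | (g₀ ≤ ‖z.1‖ ∧ g₀ ≤ ‖z.2‖) ∧ (z.1 + z.2).im = 0 ∧
    (z.1 * z.2).im = 0 ∧ (powerForm (arPoly β) z.1 z.2).re ≤ P} with hT
  have hTc : IsCompact T := by
    have hcl : IsClosed {z : ℂ × ℂ | g₀ ≤ ‖z.1‖ ∧ g₀ ≤ ‖z.2‖} :=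
      (isClosed_le continuous_const continuous_fst.norm).inter
        (isClosed_le continuous_const continuous_snd.norm)
    have hcl2 : IsClosed {z : ℂ × ℂ | (z.1 + z.2).im = 0 ∧ (z.1 * z.2).im = 0} :=
      (isClosed_eq (Complex.continuous_im.comp continuous_add) continuous_const).inter
        (isClosed_eq (Complex.continuous_im.comp continuous_mul) continuous_const)
    have hcl3 : IsClosed ({z : ℂ × ℂ | g₀ ≤ ‖z.1‖ ∧ g₀ ≤ ‖z.2‖} ∩
        (fun z : ℂ × ℂ => (powerForm (arPoly β) z.1 z.2).re) ⁻¹' Set.Iic P) :=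
      (Complex.continuous_re.comp_continuousOn ((continuousOn_powerForm hLZ).mono fun z hz =>
        ⟨hg₀.trans_le hz.1, hg₀.trans_le hz.2⟩)).preimage_isClosed_of_isClosed hcl isClosed_Iic
    refine Metric.isCompact_of_isClosed_isBounded ?_
      ((Metric.isBounded_closedBall (x := (0 : ℂ × ℂ)) (r := 1 + P * K ^ 2)).subset ?_)
    · have e : T = ({z : ℂ × ℂ | g₀ ≤ ‖z.1‖ ∧ g₀ ≤ ‖z.2‖} ∩
          (fun z : ℂ × ℂ => (powerForm (arPoly β) z.1 z.2).re) ⁻¹' Set.Iic P) ∩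
          {z : ℂ × ℂ | (z.1 + z.2).im = 0 ∧ (z.1 * z.2).im = 0} := by
        ext z
        exact ⟨fun h => ⟨⟨h.1, h.2.2.2⟩, h.2.1, h.2.2.1⟩, fun h => ⟨h.1.1, h.2.1, h.2.2, h.1.2⟩⟩
      rw [e]
      exact hcl3.inter hcl2
    · rintro z ⟨⟨h1, h2⟩, hs, hb, hq⟩
      have h1' := hg₀.trans_le h1
      have h2' := hg₀.trans_le h2
      rw [mem_closedBall_zero_iff, Prod.norm_def]
      refine max_le (hbound z h1' h2' hs hb hq) (hbound z.swap h2' h1' ?_ ?_ ?_)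
      · simpa [add_comm] using hs
      · simpa [mul_comm, add_comm] using hb
      · rwa [Prod.fst_swap, Prod.snd_swap, powerForm_comm (ne_zero_of_one_lt_norm h2')
          (ne_zero_of_one_lt_norm h1') (hLZ _ (norm_inv_lt_one h2').le)
          (hLZ _ (norm_inv_lt_one h1').le)]
  have hg₀abs : ‖(g₀ : ℂ)‖ = g₀ := by
    rw [Complex.norm_real, Real.norm_of_nonneg (by linarith)]
  have hne : ((g₀ : ℂ), (-g₀ : ℂ)) ∈ T := by
    refine ⟨⟨hg₀abs.ge, by rw [norm_neg]; exact hg₀abs.ge⟩, by simp, by simp, ?_⟩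
    exact (Complex.re_le_norm _).trans hg₀P.le
  obtain ⟨z, hz, hmax⟩ := hTc.exists_isMaxOn ⟨_, hne⟩
    (f := fun z : ℂ × ℂ => min ‖z.1‖ ‖z.2‖) (by fun_prop)
  refine ⟨2 * Real.log (min ‖z.1‖ ‖z.2‖), (hmem _).2 ⟨z, hg₀.trans_le hz.1.1, hg₀.trans_le hz.1.2,
    hz.2.1, hz.2.2.1, hz.2.2.2, rfl⟩, ?_⟩
  intro r hr
  obtain ⟨w, h1, h2, hs, hb, hq, rfl⟩ := (hmem r).1 hr
  have hwpos : 0 < min ‖w.1‖ ‖w.2‖ := lt_min (by linarith) (by linarith)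
  have : min ‖w.1‖ ‖w.2‖ ≤ min ‖z.1‖ ‖z.2‖ := by
    by_cases hw : g₀ ≤ ‖w.1‖ ∧ g₀ ≤ ‖w.2‖
    · exact hmax ⟨hw, hs, hb, hq⟩
    · refine le_trans ?_ (le_min hz.1.1 hz.1.2)
      rcases not_and_or.1 hw with h | h
      · exact (min_le_left _ _).trans (not_le.1 h).le
      · exact (min_le_right _ _).trans (not_le.1 h).le
  have := Real.log_le_log hwpos this
  linarith

end ClosedForm

/-! ### Whitening the noise -/

section Whitening

open Polynomial

theorem integral_exp_int_mul (n : ℤ) :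
    ∫ θ in (-Real.pi)..Real.pi, Complex.exp (Complex.I * (n * θ)) =
      if n = 0 then 2 * (Real.pi : ℂ) else 0 := by
  split_ifs with h
  · subst h
    simp
    ring
  · have hc : Complex.I * n ≠ 0 := mul_ne_zero Complex.I_ne_zero (by exact_mod_cast h)
    have := integral_exp_mul_complex (a := -Real.pi) (b := Real.pi) hc
    simp only [mul_assoc] at this
    rw [this, div_eq_zero_iff]
    left
    rw [sub_eq_zero, Complex.exp_eq_exp_iff_exists_int]
    exact ⟨n, by push_cast; ring⟩

variable {p : ℕ} {β : Fin p → ℂ}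

theorem continuous_SZ (hβ : ∀ k, ‖β k‖ < 1) : Continuous (SZ β) := by
  have he : Continuous fun θ : ℝ => Complex.exp (Complex.I * θ) := by fun_prop
  have hl : Continuous fun θ : ℝ => (arPoly β).eval (Complex.exp (Complex.I * θ)) :=
    (arPoly β).continuous.comp he
  have : Continuous fun θ : ℝ => 1 / (arPoly β).eval (Complex.exp (Complex.I * θ)) :=
    continuous_const.div hl fun θ => LZ_ne_zero hβ (by
      rw [mul_comm, Complex.norm_exp_ofReal_mul_I])
  exact this.norm.pow 2

/-- Since l is real, the first sum is the conjugate of the second on the unit circle, so the product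
is |L|², the reciprocal of the spectral density. -/
theorem SZ_mul_eval {l : ℝ[X]} (hl : l.map Complex.ofRealHom = arPoly β) (hβ : ∀ k, ‖β k‖ < 1)
    (θ : ℝ) :
    (SZ β θ : ℂ) * ((∑ k ∈ Finset.range (l.natDegree + 1),
        (l.coeff k : ℂ) * Complex.exp (-(Complex.I * (k * θ)))) *
      ∑ k ∈ Finset.range (l.natDegree + 1),
        (l.coeff k : ℂ) * Complex.exp (Complex.I * (k * θ))) = 1 := by
  have h0 : (arPoly β).eval (Complex.exp (Complex.I * θ)) ≠ 0 := LZ_ne_zero hβ (by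
      rw [mul_comm, Complex.norm_exp_ofReal_mul_I])
  have h1 : ∑ k ∈ Finset.range (l.natDegree + 1),
        (l.coeff k : ℂ) * Complex.exp (Complex.I * (k * θ)) =
      (arPoly β).eval (Complex.exp (Complex.I * θ)) := by
    rw [← hl, eval_map, eval₂_eq_sum_range]
    refine Finset.sum_congr rfl fun k _ => ?_
    rw [← Complex.exp_nat_mul]
    congr 2
    ring
  have h2 : ∑ k ∈ Finset.range (l.natDegree + 1),
        (l.coeff k : ℂ) * Complex.exp (-(Complex.I * (k * θ))) =
      (starRingEnd ℂ) ((arPoly β).eval (Complex.exp (Complex.I * θ))) := by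
    rw [← h1, map_sum]
    refine Finset.sum_congr rfl fun k _ => ?_
    rw [map_mul, ← Complex.exp_conj]
    simp
  rw [h1, h2, SZ, HZ, LZ, Complex.conj_mul', norm_div, norm_one]
  push_cast
  have : (‖(arPoly β).eval (Complex.exp (Complex.I * θ))‖ : ℂ) ≠ 0 := by
    exact_mod_cast norm_ne_zero_iff.2 h0
  field_simp

/-- The output at time `i + l.natDegree` of the filter `l` applied to a sequence. -/
def filtered (l : ℝ[X]) (z : ℕ → ℝ) (i : ℕ) : ℝ :=
  ∑ k ∈ Finset.range (l.natDegree + 1), l.coeff k * z (i + l.natDegree - k)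

variable {Ω : Type*} [MeasurableSpace Ω] {μ : Measure Ω}

theorem IsARNoise.memLp {Z : ℕ → Ω → ℝ} (hZ : IsARNoise β μ Z) (i : ℕ) : MemLp (Z i) 2 μ :=
  (hZ.gaussian.hasGaussianLaw_eval i).memLp_two

theorem memLp_filtered (l : ℝ[X]) {Z : ℕ → Ω → ℝ} (hZ : ∀ i, MemLp (Z i) 2 μ) (i : ℕ) :
    MemLp (fun ω => filtered l (fun n => Z n ω) i) 2 μ :=
  memLp_finsetSum _ fun _ _ => (hZ _).const_mul _

/-- Filtering by l multiplies the spectral density by |L|², which makes it 1; the covariance is then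
the integral of a pure exponential. -/
theorem covariance_filtered [IsProbabilityMeasure μ] {l : ℝ[X]}
    (hl : l.map Complex.ofRealHom = arPoly β) (hβ : ∀ k, ‖β k‖ < 1) {Z : ℕ → Ω → ℝ}
    (hZ : IsARNoise β μ Z) (i j : ℕ) :
    cov[fun ω => filtered l (fun n => Z n ω) i, fun ω => filtered l (fun n => Z n ω) j; μ] =
      if i = j then 1 else 0 := by
  unfold filtered
  rw [covariance_fun_sum_fun_sum' (fun k _ => (hZ.memLp _).const_mul _)
    (fun k _ => (hZ.memLp _).const_mul _)]
  simp only [covariance_const_mul_left, covariance_const_mul_right]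
  apply Complex.ofReal_injective
  push_cast
  simp only [hZ.covariance_eq]
  set d := l.natDegree with hd
  have key : ∀ k ∈ Finset.range (d + 1), ∀ k' ∈ Finset.range (d + 1),
      (l.coeff k' : ℂ) * ((l.coeff k : ℂ) * ((1 / (2 * Real.pi) : ℂ) *
        ∫ θ in (-Real.pi)..Real.pi, (SZ β θ : ℂ) * Complex.exp (Complex.I *
          ((((i + d - k : ℕ) : ℂ) - ((j + d - k' : ℕ) : ℂ)) * θ)))) =
      (1 / (2 * Real.pi) : ℂ) * ∫ θ in (-Real.pi)..Real.pi, (SZ β θ : ℂ) *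
        (((l.coeff k : ℂ) * Complex.exp (-(Complex.I * (k * θ)))) *
          ((l.coeff k' : ℂ) * Complex.exp (Complex.I * (k' * θ)))) *
        Complex.exp (Complex.I * (((i : ℤ) - (j : ℤ) : ℤ) * θ)) := by
    intro k hk k' hk'
    rw [Finset.mem_range] at hk hk'
    have e : ∀ θ : ℝ, (SZ β θ : ℂ) * (((l.coeff k : ℂ) * Complex.exp (-(Complex.I * (k * θ)))) *
          ((l.coeff k' : ℂ) * Complex.exp (Complex.I * (k' * θ)))) *
        Complex.exp (Complex.I * (((i : ℤ) - (j : ℤ) : ℤ) * θ)) =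
        ((l.coeff k : ℂ) * (l.coeff k' : ℂ)) * ((SZ β θ : ℂ) * Complex.exp (Complex.I *
          ((((i + d - k : ℕ) : ℂ) - ((j + d - k' : ℕ) : ℂ)) * θ))) := by
      intro θ
      -- The output index is delayed by the degree, so no natural subtraction truncates.
      rw [Nat.cast_sub (by omega), Nat.cast_sub (by omega)]
      have : Complex.exp (Complex.I * ((((i + d : ℕ) : ℂ) - k - (((j + d : ℕ) : ℂ) - k')) * θ)) =
          Complex.exp (-(Complex.I * (k * θ))) * Complex.exp (Complex.I * (k' * θ)) *
            Complex.exp (Complex.I * (((i : ℤ) - (j : ℤ) : ℤ) * θ)) := by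
        rw [← Complex.exp_add, ← Complex.exp_add]
        congr 1
        push_cast
        ring
      rw [this]
      ring
    simp only [e, intervalIntegral.integral_const_mul]
    ring
  rw [Finset.sum_congr rfl fun k hk => Finset.sum_congr rfl fun k' hk' => key k hk k' hk']
  have hint2 : ∀ k k' : ℕ, IntervalIntegrable (fun θ : ℝ => (SZ β θ : ℂ) *
        (((l.coeff k : ℂ) * Complex.exp (-(Complex.I * (k * θ)))) *
          ((l.coeff k' : ℂ) * Complex.exp (Complex.I * (k' * θ)))) *
        Complex.exp (Complex.I * (((i : ℤ) - (j : ℤ) : ℤ) * θ))) volume (-Real.pi) Real.pi :=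
    fun k k' => Continuous.intervalIntegrable (by have := continuous_SZ hβ; fun_prop) _ _
  simp only [← Finset.mul_sum]
  simp_rw [← intervalIntegral.integral_finsetSum fun k' _ => hint2 _ k']
  rw [← intervalIntegral.integral_finsetSum fun k _ => ?_]
  · have e : ∀ θ : ℝ, ∑ k ∈ Finset.range (d + 1), ∑ k' ∈ Finset.range (d + 1), (SZ β θ : ℂ) *
        (((l.coeff k : ℂ) * Complex.exp (-(Complex.I * (k * θ)))) *
          ((l.coeff k' : ℂ) * Complex.exp (Complex.I * (k' * θ)))) *
        Complex.exp (Complex.I * (((i : ℤ) - (j : ℤ) : ℤ) * θ)) =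
        Complex.exp (Complex.I * (((i : ℤ) - (j : ℤ) : ℤ) * θ)) := by
      intro θ
      simp only [← Finset.sum_mul, ← Finset.mul_sum]
      rw [SZ_mul_eval hl hβ, one_mul]
    simp only [e]
    rw [integral_exp_int_mul]
    by_cases hij : i = j
    · have : (2 * (Real.pi : ℂ)) ≠ 0 := by
        exact_mod_cast (by positivity : (2 * Real.pi) ≠ 0)
      simp only [hij, sub_self, if_true, one_div]
      rw [inv_mul_cancel₀ this, Complex.ofReal_one]
    · have : ((i : ℤ) - (j : ℤ)) ≠ 0 := by omega
      simp [hij, this]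
  · exact Continuous.intervalIntegrable (continuous_finsetSum _ fun k' _ => by
      have := continuous_SZ hβ; fun_prop) _ _

end Whitening

/-! ### The message recursion and its prediction -/

section Message

/-- The solution of `v (n + 2) = a * v (n + 1) + b * v n` with `v 0 = u₁`, `v 1 = u₂`. -/
def msgCoeff (a b u₁ u₂ : ℝ) : ℕ → ℝ
  | 0 => u₁
  | 1 => u₂
  | n + 2 => a * msgCoeff a b u₁ u₂ (n + 1) + b * msgCoeff a b u₁ u₂ n

open PowerSeries in
theorem mul_mk_msgCoeff (a b u₁ u₂ : ℝ) :
    (1 - C a * X - C b * X ^ 2) * mk (msgCoeff a b u₁ u₂) = C u₁ + C (u₂ - a * u₁) * X := by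
  ext n
  have e : (1 - C a * X - C b * X ^ 2) * mk (msgCoeff a b u₁ u₂) =
    mk (msgCoeff a b u₁ u₂) - C a * (X * mk (msgCoeff a b u₁ u₂)) -
      C b * (X ^ 2 * mk (msgCoeff a b u₁ u₂)) := by ring
  rw [e]
  simp only [map_add, map_sub, coeff_C_mul]
  match n with
  | 0 => simp [msgCoeff, coeff_X_pow_mul']
  | 1 => simp [msgCoeff, coeff_X_pow_mul', coeff_succ_X_mul]
  | n + 2 => simp [msgCoeff, coeff_X_pow_mul', coeff_succ_X_mul]

/-- With v the generating function and η = lv, v - ηg = (1 - gl)v = r(1 - aX - bX²)v, which is r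
times a polynomial of degree at most 1. The sum omits the first `l.natDegree` terms of η; they
contribute a fixed finite number of coefficients of g, which tend to 0. The term i = N is absent
because g has no constant term. -/
theorem tendsto_prediction_error {l : Polynomial ℝ} {a b q : ℝ} {g : PowerSeries ℝ}
    (hg : IsGain l a b q g) (u₁ u₂ : ℝ) :
    Tendsto (fun N => msgCoeff a b u₁ u₂ (N + l.natDegree) -
      ∑ i ∈ Finset.range N, PowerSeries.coeff (N - i) g * filtered l (msgCoeff a b u₁ u₂) i)
      atTop (𝓝 0) := by
  obtain ⟨r, hr, hid⟩ := hg.exists_quotient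
  set d := l.natDegree with hd
  set v := msgCoeff a b u₁ u₂ with hv
  set η : PowerSeries ℝ := (l : PowerSeries ℝ) * PowerSeries.mk v with hη
  have hmul : PowerSeries.mk v - η * g =
      ((Polynomial.C u₁ + Polynomial.C (u₂ - a * u₁) * Polynomial.X : Polynomial ℝ) :
        PowerSeries ℝ) * r := by
    have := mul_mk_msgCoeff a b u₁ u₂
    rw [← hv] at this
    simp only [Polynomial.coe_add, Polynomial.coe_mul, Polynomial.coe_C, Polynomial.coe_X]
    rw [← this]
    linear_combination PowerSeries.mk v * hid
  have hfil : ∀ i, PowerSeries.coeff (d + i) η = filtered l v i := by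
    intro i
    rw [hη, PowerSeries.coeff_mul, Finset.Nat.sum_antidiagonal_eq_sum_range_succ
      (fun x y => PowerSeries.coeff x (l : PowerSeries ℝ) * PowerSeries.coeff y (PowerSeries.mk v)),
      filtered]
    simp only [Polynomial.coeff_coe, PowerSeries.coeff_mk]
    rw [add_comm d i]
    symm
    refine Finset.sum_subset (Finset.range_mono (by omega)) fun k _ hk => ?_
    rw [Polynomial.coeff_eq_zero_of_natDegree_lt (by simpa using hk), zero_mul]
  have hexp : ∀ N, v (N + d) - ∑ i ∈ Finset.range N, PowerSeries.coeff (N - i) g * filtered l v i =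
      PowerSeries.coeff (N + d) (PowerSeries.mk v - η * g) +
        ∑ j ∈ Finset.range d, PowerSeries.coeff j η * PowerSeries.coeff (N + d - j) g := by
    intro N
    rw [map_sub, PowerSeries.coeff_mk, PowerSeries.coeff_mul,
      Finset.Nat.sum_antidiagonal_eq_sum_range_succ
        (fun x y => PowerSeries.coeff x η * PowerSeries.coeff y g), Finset.sum_range_succ,
      Nat.sub_self, hg.coeff_zero, mul_zero, add_zero, add_comm N d, Finset.sum_range_add]
    have : ∀ i, d + N - (d + i) = N - i := fun i => by omega
    simp only [this, hfil, mul_comm]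
    ring
  simp only [hexp]
  have t1 : Tendsto (fun N => PowerSeries.coeff (N + d) (PowerSeries.mk v - η * g)) atTop (𝓝 0) := by
    have : Tendsto (fun N => PowerSeries.coeff N (PowerSeries.mk v - η * g)) atTop (𝓝 0) := by
      rw [hmul, ← tendsto_add_atTop_iff_nat 1]
      have e : ∀ n, PowerSeries.coeff (n + 1) (((Polynomial.C u₁ + Polynomial.C (u₂ - a * u₁) *
          Polynomial.X : Polynomial ℝ) : PowerSeries ℝ) * r) =
          u₁ * PowerSeries.coeff (n + 1) r + (u₂ - a * u₁) * PowerSeries.coeff n r := by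
        intro n
        simp only [Polynomial.coe_add, Polynomial.coe_mul, Polynomial.coe_C, Polynomial.coe_X,
          add_mul, mul_assoc, map_add, PowerSeries.coeff_C_mul, PowerSeries.coeff_succ_X_mul]
      simp only [e]
      simpa using (((tendsto_add_atTop_iff_nat 1).2 hr).const_mul u₁).add
        (hr.const_mul (u₂ - a * u₁))
    exact (tendsto_add_atTop_iff_nat d).2 this
  have t2 : Tendsto (fun N => ∑ j ∈ Finset.range d,
      PowerSeries.coeff j η * PowerSeries.coeff (N + d - j) g) atTop (𝓝 0) := by
    have : Tendsto (fun N => ∑ j ∈ Finset.range d,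
      PowerSeries.coeff j η * PowerSeries.coeff (N + d - j) g) atTop
      (𝓝 (∑ j ∈ Finset.range d, PowerSeries.coeff j η * 0)) := by
      refine tendsto_finsetSum _ fun j hj => Tendsto.const_mul _ ?_
      have hj := Finset.mem_range.1 hj
      have e : ∀ N, N + d - j = N + (d - j) := fun N => by omega
      simp only [e]
      exact (tendsto_add_atTop_iff_nat (d - j)).2 hg.tendsto_coeff
    simpa using this
  simpa using t1.add t2

end Message

/-! ### The SK(2) scheme and its mean-square error -/

section Scheme

variable {Ω : Type*} [mΩ : MeasurableSpace Ω] {μ : Measure Ω}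

/-- The message process. -/
def message (U₁ U₂ : Ω → ℝ) (a b : ℝ) (n : ℕ) (ω : Ω) : ℝ :=
  msgCoeff a b 1 0 n * U₁ ω + msgCoeff a b 0 1 n * U₂ ω

theorem message_zero {Ω : Type*} {U₁ U₂ : Ω → ℝ} {a b : ℝ} : message U₁ U₂ a b 0 = U₁ := by
  ext ω; simp [message, msgCoeff]

theorem message_one {Ω : Type*} {U₁ U₂ : Ω → ℝ} {a b : ℝ} : message U₁ U₂ a b 1 = U₂ := by
  ext ω; simp [message, msgCoeff]

theorem message_add_two {Ω : Type*} {U₁ U₂ : Ω → ℝ} {a b : ℝ} (i : ℕ) (ω : Ω) :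
    message U₁ U₂ a b (i + 2) ω =
      a * message U₁ U₂ a b (i + 1) ω + b * message U₁ U₂ a b i ω := by
  simp only [message, msgCoeff]; ring

theorem message_succ_of_zero {Ω : Type*} {U₁ U₂ : Ω → ℝ} {a : ℝ} (i : ℕ) (ω : Ω) :
    message U₁ U₂ a 0 (i + 1) ω = a ^ i * message U₁ U₂ a 0 1 ω := by
  induction i with
  | zero => simp
  | succ i ih => rw [message_add_two, ih]; ring

/-- The SK(2) channel input, with the feedback estimate formed from the observations `V + Z`, which
generate the same σ-algebras as the channel outputs. -/
noncomputable def skInput (μ : Measure Ω) (V Z : ℕ → Ω → ℝ) (i : ℕ) : Ω → ℝ :=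
  if i < 2 then V i else fun ω => V i ω - (μ[V i | past (channelOutput V Z) i]) ω

theorem measurable_past_of_lt {Ω : Type*} (Y : ℕ → Ω → ℝ) {i n : ℕ} (h : i < n) :
    Measurable[past Y n] (Y i) :=
  (measurable_pi_apply (⟨i, h⟩ : Fin n)).comp (comap_measurable (initSeg Y n))

theorem past_le_iff {Ω : Type*} {Y : ℕ → Ω → ℝ} {n : ℕ} {m : MeasurableSpace Ω} :
    past Y n ≤ m ↔ ∀ i < n, Measurable[m] (Y i) := by
  refine ⟨fun h i hi => (measurable_past_of_lt Y hi).mono h le_rfl, fun h => ?_⟩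
  have : Measurable[m] (initSeg Y n) := measurable_pi_iff.2 fun i => h i i.2
  exact this.comap_le

theorem past_mono {Ω : Type*} (Y : ℕ → Ω → ℝ) {k n : ℕ} (h : k ≤ n) : past Y k ≤ past Y n :=
  past_le_iff.2 fun _ hi => measurable_past_of_lt Y (hi.trans_le h)

theorem measurable_channelOutput {V Z : ℕ → Ω → ℝ} (hV : ∀ i, Measurable (V i))
    (hZ : ∀ i, Measurable (Z i)) (i : ℕ) : Measurable (channelOutput V Z i) :=
  (hV i).add (hZ i)

theorem past_le {Y : ℕ → Ω → ℝ} (hY : ∀ i, Measurable (Y i)) (n : ℕ) : past Y n ≤ mΩ :=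
  past_le_iff.2 fun i _ => hY i

theorem exists_skInput_eq (μ : Measure Ω) (V Z : ℕ → Ω → ℝ) (i : ℕ) :
    ∃ c : Ω → ℝ, Measurable[past (channelOutput V Z) i] c ∧
      ∀ ω, skInput μ V Z i ω = V i ω - c ω := by
  rw [skInput]
  split_ifs with h
  · exact ⟨fun _ => 0, measurable_const, fun ω => by simp⟩
  · exact ⟨_, stronglyMeasurable_condExp.measurable, fun ω => rfl⟩

/-- At each time the two outputs differ by a function of the past, so each sequence is recovered
from the other by induction. This lets the input be defined without circularity. -/
theorem past_skInput (μ : Measure Ω) (V Z : ℕ → Ω → ℝ) (n : ℕ) :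
    past (channelOutput (skInput μ V Z) Z) n = past (channelOutput V Z) n := by
  refine le_antisymm (past_le_iff.2 fun i hi => ?_) ?_
  · obtain ⟨c, hc, h⟩ := exists_skInput_eq μ V Z i
    have e : channelOutput (skInput μ V Z) Z i = fun ω => channelOutput V Z i ω - c ω := by
      ext ω; simp only [channelOutput, h]; ring
    rw [e]
    exact (measurable_past_of_lt _ hi).sub (hc.mono (past_mono _ hi.le) le_rfl)
  · induction n with
    | zero => exact past_le_iff.2 fun i hi => absurd hi (Nat.not_lt_zero i)
    | succ n ih =>
      refine past_le_iff.2 fun i hi => ?_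
      rcases Nat.lt_succ_iff_lt_or_eq.1 hi with hi' | rfl
      · exact (measurable_past_of_lt _ hi').mono (ih.trans (past_mono _ n.le_succ)) le_rfl
      · obtain ⟨c, hc, h⟩ := exists_skInput_eq μ V Z i
        have e : channelOutput V Z i =
            fun ω => channelOutput (skInput μ V Z) Z i ω + c ω := by
          ext ω; simp only [channelOutput, h]; ring
        rw [e]
        exact (measurable_past_of_lt _ hi).add (hc.mono (ih.trans (past_mono _ i.le_succ)) le_rfl)

theorem measurable_skInput {V Z : ℕ → Ω → ℝ} (hV : ∀ i, Measurable (V i))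
    (hZ : ∀ i, Measurable (Z i)) (i : ℕ) : Measurable (skInput μ V Z i) := by
  obtain ⟨c, hc, h⟩ := exists_skInput_eq μ V Z i
  have e : skInput μ V Z i = fun ω => V i ω - c ω := funext h
  rw [e]
  exact (hV i).sub (hc.mono (past_le (measurable_channelOutput hV hZ) i) le_rfl)

theorem isSK2Pair_skInput {Z : ℕ → Ω → ℝ} (hZ : ∀ i, Measurable (Z i)) {U₁ U₂ : Ω → ℝ}
    (hU₁ : Measurable U₁) (hU₂ : Measurable U₂) (a b : ℝ) :
    IsSK2Pair μ Z U₁ U₂ a b (message U₁ U₂ a b) (skInput μ (message U₁ U₂ a b) Z) where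
  V_one := by ext ω; simp [message, msgCoeff]
  V_two := by ext ω; simp [message, msgCoeff]
  V_rec i := by ext ω; simp only [message, msgCoeff]; ring
  X_measurable := measurable_skInput
    (fun i => (hU₁.const_mul _).add (hU₂.const_mul _)) hZ
  X_one := by ext ω; simp [skInput, message, msgCoeff]
  X_two := by ext ω; simp [skInput, message, msgCoeff]
  X_eq i hi := by
    rw [past_skInput, skInput, if_neg (by omega)]

theorem memLp_skInput [IsProbabilityMeasure μ] {V Z : ℕ → Ω → ℝ} (hV : ∀ i, MemLp (V i) 2 μ)
    (i : ℕ) : MemLp (skInput μ V Z i) 2 μ := by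
  rw [skInput]
  split_ifs
  · exact hV i
  · exact (hV i).sub ((hV i).condExp one_le_two)

/-- The feedback estimate is at least as good as any estimate based on the same observations. -/
theorem integral_skInput_sq_le [IsProbabilityMeasure μ] {V Z : ℕ → Ω → ℝ}
    (hV : ∀ i, Measurable (V i)) (hZ : ∀ i, Measurable (Z i)) (hV2 : ∀ i, MemLp (V i) 2 μ)
    {n : ℕ} (hn : 2 ≤ n) {f : Ω → ℝ} (hf : Measurable[past (channelOutput V Z) n] f)
    (hf2 : MemLp f 2 μ) :
    ∫ ω, skInput μ V Z n ω ^ 2 ∂μ ≤ Var[fun ω => V n ω - f ω; μ] := by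
  have hm := past_le (measurable_channelOutput hV hZ) n
  have hW : MemLp (fun ω => V n ω - f ω) 2 μ := (hV2 n).sub hf2
  -- Law of total variance: subtracting f, measurable in the past, does not change the conditional
  -- variance, whose mean is the power of the input.
  rw [← integral_condVar_add_variance_condExp hm hW]
  have e : ∫ ω, skInput μ V Z n ω ^ 2 ∂μ =
      ∫ ω, Var[fun ω => V n ω - f ω; μ | past (channelOutput V Z) n] ω ∂μ := by
    rw [condVar, integral_condExp hm]
    refine integral_congr_ae ?_
    have h1 : μ[fun ω => V n ω - f ω | past (channelOutput V Z) n] =ᵐ[μ]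
        μ[V n | past (channelOutput V Z) n] - μ[f | past (channelOutput V Z) n] :=
      condExp_sub ((hV2 n).integrable one_le_two) (hf2.integrable one_le_two) _
    have h2 : μ[f | past (channelOutput V Z) n] = f :=
      condExp_of_stronglyMeasurable hm hf.stronglyMeasurable (hf2.integrable one_le_two)
    filter_upwards [h1] with ω hω
    rw [h2] at hω
    simp only [Pi.sub_apply, Pi.pow_apply] at hω ⊢
    rw [skInput, if_neg (by omega), hω]
    ring
  rw [e]
  exact le_add_of_nonneg_right (variance_nonneg _ _)

variable {p : ℕ} {β : Fin p → ℂ} {Z : ℕ → Ω → ℝ} {U₁ U₂ : Ω → ℝ} {a b q : ℝ}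
  {l : Polynomial ℝ} {g : PowerSeries ℝ}

theorem variance_eq_one_of_hasLaw [IsProbabilityMeasure μ] {U : Ω → ℝ}
    (hU : HasLaw U (gaussianReal 0 1) μ) : Var[U; μ] = 1 := by
  rw [hU.variance_eq, variance_id_gaussianReal]
  rfl

theorem memLp_two_of_hasLaw [IsProbabilityMeasure μ] {U : Ω → ℝ}
    (hU : HasLaw U (gaussianReal 0 1) μ) : MemLp U 2 μ := by
  have : MemLp id 2 (gaussianReal 0 1) := memLp_id_gaussianReal 2
  rw [← hU.map_eq] at this
  exact (memLp_map_measure_iff (by fun_prop) hU.aemeasurable).1 this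

theorem memLp_message [IsProbabilityMeasure μ]
    (hU₁ : HasLaw U₁ (gaussianReal 0 1) μ) (hU₂ : HasLaw U₂ (gaussianReal 0 1) μ) (i : ℕ) :
    MemLp (message U₁ U₂ a b i) 2 μ :=
  ((memLp_two_of_hasLaw hU₁).const_mul _).add ((memLp_two_of_hasLaw hU₂).const_mul _)

theorem sum_sq_coeff_le (hg : IsGain l a b q g) (N : ℕ) :
    ∑ i ∈ Finset.range N, PowerSeries.coeff (N - i) g ^ 2 ≤ q := by
  have h1 : ∑ i ∈ Finset.range N, PowerSeries.coeff (N - i) g ^ 2 =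
      ∑ j ∈ Finset.range N, PowerSeries.coeff (j + 1) g ^ 2 := by
    rw [← Finset.sum_range_reflect (fun j => PowerSeries.coeff (j + 1) g ^ 2)]
    refine Finset.sum_congr rfl fun i hi => ?_
    have := Finset.mem_range.1 hi
    congr 3
    omega
  have h2 := sum_le_hasSum (Finset.range (N + 1)) (fun _ _ => sq_nonneg _) hg.hasSum
  rw [Finset.sum_range_succ'] at h2
  rw [h1]
  have := sq_nonneg (PowerSeries.coeff 0 g)
  linarith

theorem filtered_add (z w : ℕ → ℝ) (i : ℕ) :
    filtered l (fun n => z n + w n) i = filtered l z i + filtered l w i := by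
  simp only [filtered, mul_add, Finset.sum_add_distrib]

theorem filtered_mul_const (z : ℕ → ℝ) (c : ℝ) (i : ℕ) :
    filtered l (fun n => z n * c) i = filtered l z i * c := by
  simp only [filtered, Finset.sum_mul, mul_assoc]

/-- Compare with the linear estimate f that whitens V + Z and applies g. Its error is the transient,
linear in (U₁, U₂), minus white noise through g. The two are independent, so variances add, and
whiteness bounds the second by the energy of g. -/
theorem integral_skInput_sq_le_of_isGain [IsProbabilityMeasure μ]
    (hl : l.map Complex.ofRealHom = arPoly β) (hβ : ∀ k, ‖β k‖ < 1) (hZ : IsARNoise β μ Z)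
    (hU₁ : Measurable U₁) (hU₂ : Measurable U₂)
    (hU₁_law : HasLaw U₁ (gaussianReal 0 1) μ) (hU₂_law : HasLaw U₂ (gaussianReal 0 1) μ)
    (hU : IndepFun U₁ U₂ μ) (hUZ : IndepFun (fun ω => (U₁ ω, U₂ ω)) (fun ω i => Z i ω) μ)
    (hg : IsGain l a b q g) {N : ℕ} (hN : 2 ≤ N + l.natDegree) :
    ∫ ω, skInput μ (message U₁ U₂ a b) Z (N + l.natDegree) ω ^ 2 ∂μ ≤
      (msgCoeff a b 1 0 (N + l.natDegree) -
        ∑ i ∈ Finset.range N, PowerSeries.coeff (N - i) g * filtered l (msgCoeff a b 1 0) i) ^ 2 +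
      (msgCoeff a b 0 1 (N + l.natDegree) -
        ∑ i ∈ Finset.range N, PowerSeries.coeff (N - i) g * filtered l (msgCoeff a b 0 1) i) ^ 2 +
      q := by
  set d := l.natDegree with hd
  set V := message U₁ U₂ a b with hV
  set D₁ := msgCoeff a b 1 0 (N + d) -
    ∑ i ∈ Finset.range N, PowerSeries.coeff (N - i) g * filtered l (msgCoeff a b 1 0) i with hD₁
  set D₂ := msgCoeff a b 0 1 (N + d) -
    ∑ i ∈ Finset.range N, PowerSeries.coeff (N - i) g * filtered l (msgCoeff a b 0 1) i with hD₂
  have hVm : ∀ i, Measurable (V i) := fun i => (hU₁.const_mul _).add (hU₂.const_mul _)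
  have hV2 : ∀ i, MemLp (V i) 2 μ := memLp_message hU₁_law hU₂_law
  have hZ2 : ∀ i, MemLp (Z i) 2 μ := hZ.memLp
  set W : ℕ → Ω → ℝ := fun i ω => filtered l (fun n => Z n ω) i with hW
  have hW2 : ∀ i, MemLp (W i) 2 μ := memLp_filtered l hZ2
  set f : Ω → ℝ := fun ω => ∑ i ∈ Finset.range N,
    PowerSeries.coeff (N - i) g * filtered l (fun n => channelOutput V Z n ω) i with hf
  -- Only i < N occurs, so f uses outputs strictly before time N + d.
  have hfm : Measurable[past (channelOutput V Z) (N + d)] f := by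
    refine Finset.measurable_fun_sum _ fun i hi => Measurable.const_mul ?_ _
    refine Finset.measurable_fun_sum _ fun k _ => Measurable.const_mul ?_ _
    have := Finset.mem_range.1 hi
    exact measurable_past_of_lt _ (by omega)
  have hf2 : MemLp f 2 μ := memLp_finsetSum _ fun i _ =>
    (memLp_filtered l (fun n => (hV2 n).add (hZ2 n)) i).const_mul _
  refine (integral_skInput_sq_le hVm hZ.measurable hV2 hN hfm hf2).trans ?_
  set A : Ω → ℝ := fun ω => D₁ * U₁ ω + D₂ * U₂ ω with hA
  set B : Ω → ℝ := fun ω => ∑ i ∈ Finset.range N, PowerSeries.coeff (N - i) g * W i ω with hB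
  have hsplit : (fun ω => V (N + d) ω - f ω) = A - B := by
    ext ω
    have e : ∀ i, filtered l (fun n => channelOutput V Z n ω) i =
        filtered l (msgCoeff a b 1 0) i * U₁ ω + filtered l (msgCoeff a b 0 1) i * U₂ ω + W i ω := by
      intro i
      simp only [hW, channelOutput, hV, message, filtered_add, filtered_mul_const]
    simp only [hf, hA, hB, Pi.sub_apply, e]
    simp only [hV, message, hD₁, hD₂, mul_add, Finset.sum_add_distrib,
      sub_mul, Finset.sum_mul, mul_assoc]
    ring
  have hA2 : MemLp A 2 μ :=
    ((memLp_two_of_hasLaw hU₁_law).const_mul _).add ((memLp_two_of_hasLaw hU₂_law).const_mul _)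
  have hB2 : MemLp B 2 μ := memLp_finsetSum _ fun i _ => (hW2 i).const_mul _
  have hAB : cov[A, B; μ] = 0 := by
    have hi : IndepFun A B μ := by
      have hφ : Measurable fun u : ℝ × ℝ => D₁ * u.1 + D₂ * u.2 := by fun_prop
      have hψ : Measurable fun z : ℕ → ℝ => ∑ i ∈ Finset.range N,
          PowerSeries.coeff (N - i) g * filtered l z i := by
        unfold filtered
        fun_prop
      exact hUZ.comp hφ hψ
    exact hi.covariance_eq_zero hA2 hB2
  have hvA : Var[A; μ] = D₁ ^ 2 + D₂ ^ 2 := by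
    have h1 : IndepFun (fun ω => D₁ * U₁ ω) (fun ω => D₂ * U₂ ω) μ :=
      hU.comp (measurable_const_mul D₁) (measurable_const_mul D₂)
    have := h1.variance_add ((memLp_two_of_hasLaw hU₁_law).const_mul D₁)
      ((memLp_two_of_hasLaw hU₂_law).const_mul D₂)
    rw [variance_const_mul, variance_const_mul, variance_eq_one_of_hasLaw hU₁_law,
      variance_eq_one_of_hasLaw hU₂_law, mul_one, mul_one] at this
    exact this
  have hvB : Var[B; μ] ≤ q := by
    refine le_trans (le_of_eq ?_) (sum_sq_coeff_le hg N)
    rw [hB, variance_fun_sum' fun i _ => (hW2 i).const_mul _]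
    simp only [covariance_const_mul_left, covariance_const_mul_right]
    refine Finset.sum_congr rfl fun i hi => ?_
    simp only [hW, covariance_filtered hl hβ hZ]
    rw [Finset.sum_eq_single i]
    · simp [sq]
    · intro j _ hj
      simp [hj.symm]
    · exact fun h => absurd hi h
  rw [hsplit, variance_sub hA2 hB2, hAB, hvA]
  linarith

end Scheme

/-! ### Lower bounds on mutual information -/

section Divergence

/-- Donsker-Varadhan with test function log(1/c) on s and 0 elsewhere: its exponential moment under
ν₂ is at most 1 + ν₂(s)/c ≤ 2. -/
theorem le_klDiv_of_measurableSet {α : Type*} [MeasurableSpace α] {ν₁ ν₂ : Measure α}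
    [IsProbabilityMeasure ν₁] [IsProbabilityMeasure ν₂] {s : Set α} (hs : MeasurableSet s) {c : ℝ}
    (hc : 0 < c) (hsc : ν₂.real s ≤ c) :
    ENNReal.ofReal (ν₁.real s * -Real.log c - Real.log 2) ≤ InformationTheory.klDiv ν₁ ν₂ := by
  by_cases h : ν₁ ≪ ν₂ ∧ Integrable (llr ν₁ ν₂) ν₁
  swap
  · rw [not_and] at h
    rw [InformationTheory.klDiv_eq_top_iff.2 h]
    exact le_top
  obtain ⟨hac, hint⟩ := h
  rw [InformationTheory.klDiv_of_ac_of_integrable hac hint]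
  apply ENNReal.ofReal_le_ofReal
  simp only [probReal_univ, add_sub_cancel_right]
  set f : α → ℝ := s.indicator fun _ => -Real.log c with hf
  have hexp : (fun x => Real.exp (f x)) = fun x => 1 + s.indicator (fun _ => c⁻¹ - 1) x := by
    ext x
    by_cases hx : x ∈ s
    · simp [hf, hx, Real.exp_neg, Real.exp_log hc]
    · simp [hf, hx]
  have hi : Integrable (s.indicator fun _ => c⁻¹ - 1) ν₂ := (integrable_const _).indicator hs
  have hfe : Integrable (fun x => Real.exp (f x)) ν₂ := by
    rw [hexp]
    exact (integrable_const _).add hi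
  have hfi : Integrable f ν₁ := (integrable_const _).indicator hs
  have hprob := isProbabilityMeasure_tilted hfe
  -- The variational bound is nonnegativity of the divergence from ν₁ to the tilted measure.
  have hac' : ν₁ ≪ ν₂.tilted f := hac.trans (absolutelyContinuous_tilted hfe)
  have h0 := InformationTheory.integral_llr_add_sub_measure_univ_nonneg hac'
    (integrable_llr_tilted_right hac hfi hint hfe)
  simp only [probReal_univ, add_sub_cancel_right] at h0
  rw [integral_llr_tilted_right hac hfi hfe hint] at h0
  have h1 : ∫ x, f x ∂ν₁ = ν₁.real s * -Real.log c := by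
    rw [hf, integral_indicator_const _ hs, smul_eq_mul]
  have h2 : ∫ x, Real.exp (f x) ∂ν₂ ≤ 2 := by
    rw [hexp, integral_add (integrable_const _) hi, integral_indicator_const _ hs, smul_eq_mul]
    simp only [integral_const, probReal_univ, smul_eq_mul, mul_one]
    have : ν₂.real s * c⁻¹ ≤ 1 := by
      rw [← div_eq_mul_inv]; exact div_le_one_of_le₀ hsc hc.le
    have := measureReal_nonneg (μ := ν₂) (s := s)
    linarith
  have h3 := Real.log_le_log (integral_exp_pos hfe) h2
  linarith

theorem prod_real_le_of_slices {α γ : Type*} [MeasurableSpace α] [MeasurableSpace γ]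
    {ν₁ : Measure α} {ν₂ : Measure γ} [IsProbabilityMeasure ν₁] [IsProbabilityMeasure ν₂]
    {s : Set (α × γ)} (hs : MeasurableSet s) {c : ℝ} (hc : 0 ≤ c)
    (h : ∀ y, ν₁ {x | (x, y) ∈ s} ≤ ENNReal.ofReal c) : (ν₁.prod ν₂).real s ≤ c := by
  rw [measureReal_def]
  refine ENNReal.toReal_le_of_le_ofReal hc ?_
  rw [Measure.prod_apply_symm hs]
  calc ∫⁻ y, ν₁ ((fun x => (x, y)) ⁻¹' s) ∂ν₂ ≤ ∫⁻ _, ENNReal.ofReal c ∂ν₂ := lintegral_mono h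
    _ = ENNReal.ofReal c := by simp

theorem gaussianReal_Icc_le (t r : ℝ) :
    gaussianReal 0 1 (Set.Icc (t - r) (t + r)) ≤ ENNReal.ofReal (2 * r) := by
  rw [gaussianReal_apply 0 one_ne_zero]
  calc ∫⁻ x in Set.Icc (t - r) (t + r), gaussianPDF 0 1 x
      ≤ ∫⁻ _ in Set.Icc (t - r) (t + r), 1 := by
        refine lintegral_mono fun x => ?_
        rw [gaussianPDF, ← ENNReal.ofReal_one]
        apply ENNReal.ofReal_le_ofReal
        rw [gaussianPDFReal]
        have h1 : (√(2 * Real.pi * ((1 : NNReal) : ℝ)))⁻¹ ≤ 1 := by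
          apply inv_le_one_of_one_le₀
          rw [Real.one_le_sqrt]
          have := Real.pi_gt_three
          push_cast
          linarith
        have h2 : Real.exp (-(x - 0) ^ 2 / (2 * ((1 : NNReal) : ℝ))) ≤ 1 := by
          rw [Real.exp_le_one_iff]
          apply div_nonpos_of_nonpos_of_nonneg
          · have := sq_nonneg (x - 0)
            linarith
          · positivity
        exact mul_le_one₀ h1 (Real.exp_pos _).le h2
    _ = ENNReal.ofReal (2 * r) := by
        simp only [lintegral_const, Measure.restrict_apply MeasurableSet.univ, Set.univ_inter,
          one_mul, Real.volume_Icc]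
        congr 1
        ring

variable {Ω : Type*} [mΩ : MeasurableSpace Ω] {μ : Measure Ω}

theorem measurable_initSeg {Y : ℕ → Ω → ℝ} (hY : ∀ i, Measurable (Y i)) (n : ℕ) :
    Measurable (initSeg Y n) :=
  measurable_pi_iff.2 fun i => hY i

/-- The sets are nearly certain under the joint law and exponentially small under the product law;
the constants K and log 2 vanish after division by the length. -/
theorem le_mutualInfoRate [IsProbabilityMeasure μ] {V Y : ℕ → Ω → ℝ}
    (hV : ∀ i, Measurable (V i)) (hY : ∀ i, Measurable (Y i))
    (s : ∀ n, Set ((Fin (n + 2) → ℝ) × (Fin (n + 2) → ℝ))) (hs : ∀ n, MeasurableSet (s n))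
    {ε : ℕ → ℝ} (hε : Tendsto ε atTop (𝓝 0))
    (hJ : ∀ n, 1 - ε n ≤ μ.real {ω | (initSeg V (n + 2) ω, initSeg Y (n + 2) ω) ∈ s n})
    {K R : ℝ} (hK : 0 < K) (hR : 0 ≤ R)
    (hQ : ∀ n : ℕ, ((μ.map (initSeg V (n + 2))).prod (μ.map (initSeg Y (n + 2)))).real (s n) ≤
      K * Real.exp (-(R * n))) :
    ENNReal.ofReal R ≤ mutualInfoRate μ V Y := by
  rw [mutualInfoRate, ← liminf_nat_add _ 2]
  set low : ℕ → ℝ := fun n => ((1 - ε n) * R * n - |Real.log K| - Real.log 2) / (n + 2) with hlow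
  have hlim : Tendsto low atTop (𝓝 R) := by
    have t1 : Tendsto (fun n : ℕ => (n : ℝ) / (n + 2)) atTop (𝓝 1) := tendsto_natCast_div_add_atTop 2
    have t2 : Tendsto (fun n : ℕ => (|Real.log K| + Real.log 2) / ((n : ℝ) + 2)) atTop (𝓝 0) :=
      (tendsto_atTop_add_const_right _ 2 tendsto_natCast_atTop_atTop).const_div_atTop _
    have t3 : Tendsto (fun n => (1 - ε n) * R) atTop (𝓝 R) := by
      simpa using (hε.const_sub 1).mul_const R
    have := (t3.mul t1).sub t2
    rw [mul_one, sub_zero] at this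
    refine this.congr fun n => ?_
    simp only [hlow]
    ring
  have hle : ∀ n, ENNReal.ofReal (low n) ≤
      mutualInfo μ (initSeg V (n + 2)) (initSeg Y (n + 2)) / ((n + 2 : ℕ) : ℝ≥0∞) := by
    intro n
    have mV := measurable_initSeg hV (n + 2)
    have mY := measurable_initSeg hY (n + 2)
    have := Measure.isProbabilityMeasure_map (μ := μ) mV.aemeasurable
    have := Measure.isProbabilityMeasure_map (μ := μ) mY.aemeasurable
    have := Measure.isProbabilityMeasure_map (μ := μ) (mV.prodMk mY).aemeasurable
    have hkl := le_klDiv_of_measurableSet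
      (ν₁ := μ.map fun ω => (initSeg V (n + 2) ω, initSeg Y (n + 2) ω)) (hs n) (by positivity) (hQ n)
    rw [map_measureReal_apply (mV.prodMk mY) (hs n), Real.log_mul hK.ne' (Real.exp_pos _).ne',
      Real.log_exp] at hkl
    have hJn := hJ n
    set J := μ.real {ω | (initSeg V (n + 2) ω, initSeg Y (n + 2) ω) ∈ s n} with hJdef
    have hJ1 : J ≤ 1 := measureReal_le_one
    have hJ0 : 0 ≤ J := measureReal_nonneg
    have hnum : (1 - ε n) * R * n - |Real.log K| - Real.log 2 ≤
        J * -(Real.log K + -(R * n)) - Real.log 2 := by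
      have h1 : (1 - ε n) * (R * n) ≤ J * (R * n) :=
        mul_le_mul_of_nonneg_right hJn (by positivity)
      have h2 : J * Real.log K ≤ |Real.log K| :=
        (mul_le_mul_of_nonneg_left (le_abs_self _) hJ0).trans
          (mul_le_of_le_one_left (abs_nonneg _) hJ1)
      linarith
    have hpos : (0 : ℝ) < n + 2 := by positivity
    rw [hlow]
    simp only
    rw [ENNReal.ofReal_div_of_pos hpos]
    have e : ENNReal.ofReal ((n : ℝ) + 2) = ((n + 2 : ℕ) : ℝ≥0∞) := by
      rw [← ENNReal.ofReal_natCast]; push_cast; rfl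
    rw [e]
    gcongr
    exact (ENNReal.ofReal_le_ofReal hnum).trans hkl
  rw [← (ENNReal.tendsto_ofReal hlim).liminf_eq]
  exact liminf_le_liminf (Eventually.of_forall hle)

end Divergence

/-! ### From one-step bounds to average power -/

section Power

variable {Ω : Type*} [mΩ : MeasurableSpace Ω] {μ : Measure Ω}

/-- Taking the maximum with q turns a one-sided asymptotic bound into convergence, ready for Cesàro
averaging. -/
theorem tendsto_max_of_shift {e c : ℕ → ℝ} {q : ℝ} {d : ℕ} (hc : Tendsto c atTop (𝓝 0))
    (h : ∀ᶠ N in atTop, e (N + d) ≤ c N + q) :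
    Tendsto (fun n => max (e n) q) atTop (𝓝 q) := by
  rw [← tendsto_add_atTop_iff_nat d]
  have hc' : Tendsto (fun N => |c N| + q) atTop (𝓝 q) := by simpa using hc.abs.add_const q
  refine tendsto_of_tendsto_of_tendsto_of_le_of_le' tendsto_const_nhds hc'
    (Eventually.of_forall fun _ => le_max_right _ _) ?_
  filter_upwards [h] with N hN
  exact max_le (hN.trans (by linarith [le_abs_self (c N)])) (by linarith [abs_nonneg (c N)])

theorem limsup_avgPower_le [IsProbabilityMeasure μ] {X : ℕ → Ω → ℝ} (hX : ∀ i, MemLp (X i) 2 μ)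
    {q : ℝ} (h : Tendsto (fun n => max (∫ ω, X n ω ^ 2 ∂μ) q) atTop (𝓝 q)) :
    limsup (avgPower μ X) atTop ≤ ENNReal.ofReal q := by
  rw [← (ENNReal.tendsto_ofReal h.cesaro).limsup_eq]
  refine limsup_le_limsup (Eventually.of_forall fun n => ?_)
  rw [avgPower]
  rcases Nat.eq_zero_or_pos n with rfl | hn
  · simp
  have hn' : (0 : ℝ) < n := by exact_mod_cast hn
  have e : ∀ i, ∫⁻ ω, ENNReal.ofReal (X i ω ^ 2) ∂μ = ENNReal.ofReal (∫ ω, X i ω ^ 2 ∂μ) := fun i =>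
    (ofReal_integral_eq_lintegral_ofReal (hX i).integrable_sq
      (Eventually.of_forall fun _ => sq_nonneg _)).symm
  simp only [e]
  rw [← ENNReal.ofReal_sum_of_nonneg fun i _ => integral_nonneg fun _ => sq_nonneg _,
    ← ENNReal.ofReal_natCast, ← ENNReal.ofReal_div_of_pos hn', inv_mul_eq_div]
  apply ENNReal.ofReal_le_ofReal
  gcongr
  exact le_max_left _ _

end Power

/-! ### Asymptotic power of the scheme -/

section Power

variable {p : ℕ} {β : Fin p → ℂ} {Ω : Type*} [mΩ : MeasurableSpace Ω] {μ : Measure Ω}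
  {U₁ U₂ : Ω → ℝ} {Z : ℕ → Ω → ℝ} {l : Polynomial ℝ} {a b q : ℝ} {g : PowerSeries ℝ}

theorem tendsto_max_integral_skInput_sq [IsProbabilityMeasure μ]
    (hl : l.map Complex.ofRealHom = arPoly β) (hβ : ∀ k, ‖β k‖ < 1) (hZ : IsARNoise β μ Z)
    (hU₁ : Measurable U₁) (hU₂ : Measurable U₂)
    (hU₁_law : HasLaw U₁ (gaussianReal 0 1) μ) (hU₂_law : HasLaw U₂ (gaussianReal 0 1) μ)
    (hU : IndepFun U₁ U₂ μ) (hUZ : IndepFun (fun ω => (U₁ ω, U₂ ω)) (fun ω i => Z i ω) μ)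
    (hg : IsGain l a b q g) :
    Tendsto (fun n => max (∫ ω, skInput μ (message U₁ U₂ a b) Z n ω ^ 2 ∂μ) q) atTop (𝓝 q) := by
  have h := ((tendsto_prediction_error hg 1 0).pow 2).add ((tendsto_prediction_error hg 0 1).pow 2)
  rw [zero_pow two_ne_zero, add_zero] at h
  refine tendsto_max_of_shift h (d := l.natDegree) ?_
  filter_upwards [eventually_ge_atTop 2] with N hN
  exact integral_skInput_sq_le_of_isGain hl hβ hZ hU₁ hU₂ hU₁_law hU₂_law hU hUZ hg (by omega)

end Power

/-! ### Recovering the initial message from the outputs -/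

section Estimation

variable {Ω : Type*} [mΩ : MeasurableSpace Ω] {μ : Measure Ω} {U₁ U₂ : Ω → ℝ} {V Z : ℕ → Ω → ℝ}

/-- Replacing V by the feedback estimates in U = pV_n + qV_{n+1} leaves the error pX_n + qX_{n+1},
which Markov's inequality for its square controls. -/
theorem exists_estimator [IsProbabilityMeasure μ] (hV : ∀ i, MemLp (V i) 2 μ) {B : ℝ}
    (hB : ∀ n, ∫ ω, skInput μ V Z n ω ^ 2 ∂μ ≤ B) {U : Ω → ℝ} {n : ℕ} {p q : ℝ}
    (hU : ∀ ω, U ω = p * V n ω + q * V (n + 1) ω) {r : ℝ} (hr : 0 < r) :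
    ∃ φ : (Fin (n + 2) → ℝ) → ℝ, Measurable φ ∧
      μ.real {ω | r < |U ω - φ (initSeg (channelOutput (skInput μ V Z) Z) (n + 2) ω)|} ≤
        2 * (p ^ 2 + q ^ 2) * B / r ^ 2 := by
  obtain ⟨c, hc, hcX⟩ := exists_skInput_eq μ V Z n
  obtain ⟨c', hc', hcX'⟩ := exists_skInput_eq μ V Z (n + 1)
  have hm : Measurable[past (channelOutput (skInput μ V Z) Z) (n + 2)]
      fun ω => p * c ω + q * c' ω := by
    rw [past_skInput]
    exact ((hc.mono (past_mono _ (by omega)) le_rfl).const_mul p).add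
      ((hc'.mono (past_mono _ (by omega)) le_rfl).const_mul q)
  -- Doob-Dynkin factorization through the observed segment.
  obtain ⟨φ, hφ, hφe⟩ := hm.exists_eq_measurable_comp
  refine ⟨φ, hφ, ?_⟩
  set X := skInput μ V Z with hX
  have e : ∀ ω, U ω - φ (initSeg (channelOutput X Z) (n + 2) ω) = p * X n ω + q * X (n + 1) ω := by
    intro ω
    have := congrFun hφe ω
    simp only [Function.comp_apply] at this
    rw [← this, hU, hcX, hcX']
    ring
  simp only [e]
  have hXi : ∀ i, Integrable (fun ω => X i ω ^ 2) μ := fun i => (memLp_skInput hV i).integrable_sq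
  have hI : Integrable (fun ω => 2 * p ^ 2 * X n ω ^ 2 + 2 * q ^ 2 * X (n + 1) ω ^ 2) μ :=
    ((hXi n).const_mul _).add ((hXi (n + 1)).const_mul _)
  have hmk := mul_meas_ge_le_integral_of_nonneg (μ := μ)
    (f := fun ω => 2 * p ^ 2 * X n ω ^ 2 + 2 * q ^ 2 * X (n + 1) ω ^ 2)
    (ae_of_all _ fun ω => by simp only [Pi.zero_apply]; positivity) hI (r ^ 2)
  rw [integral_add ((hXi n).const_mul _) ((hXi (n + 1)).const_mul _), integral_const_mul,
    integral_const_mul] at hmk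
  rw [le_div_iff₀ (by positivity), mul_comm]
  have hsub : μ.real {ω | r < |p * X n ω + q * X (n + 1) ω|} ≤
      μ.real {ω | r ^ 2 ≤ 2 * p ^ 2 * X n ω ^ 2 + 2 * q ^ 2 * X (n + 1) ω ^ 2} := by
    refine measureReal_mono fun ω hω => ?_
    simp only [Set.mem_ofPred_eq] at hω ⊢
    have h1 : r ^ 2 ≤ (p * X n ω + q * X (n + 1) ω) ^ 2 := by
      rw [← sq_abs (p * X n ω + q * X (n + 1) ω)]
      exact pow_le_pow_left₀ hr.le hω.le 2
    nlinarith [sq_nonneg (p * X n ω - q * X (n + 1) ω)]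
  have h2 := mul_le_mul_of_nonneg_left hsub (sq_nonneg r)
  have h3 := mul_le_mul_of_nonneg_left (hB n) (by positivity : 0 ≤ 2 * p ^ 2)
  have h4 := mul_le_mul_of_nonneg_left (hB (n + 1)) (by positivity : 0 ≤ 2 * q ^ 2)
  linarith

/-- The gap κ < κ' absorbs the factor n + 1. -/
theorem tendsto_error_bound {p q : ℕ → ℝ} {C κ κ' : ℝ} (hκ : 0 ≤ κ) (hκ' : κ < κ')
    (hp : ∀ n : ℕ, |p n| ≤ C * (n + 1) * κ ^ n) (hq : ∀ n : ℕ, |q n| ≤ C * (n + 1) * κ ^ n)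
    (B : ℝ) :
    Tendsto (fun n => 2 * (p n ^ 2 + q n ^ 2) * B / (κ' ^ n) ^ 2) atTop (𝓝 0) := by
  have h0 : 0 < κ' := hκ.trans_lt hκ'
  have hρ0 : 0 ≤ κ / κ' := by positivity
  have hρ : κ / κ' < 1 := (div_lt_one h0).2 hκ'
  have hs : Tendsto (fun n : ℕ => C * (((n : ℝ) + 1) * (κ / κ') ^ n)) atTop (𝓝 0) := by
    have := (summable_succ_mul_pow hρ0 hρ).tendsto_atTop_zero
    simpa using this.const_mul C
  have key : ∀ w : ℕ → ℝ, (∀ n : ℕ, |w n| ≤ C * (n + 1) * κ ^ n) →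
      Tendsto (fun n => (w n / κ' ^ n) ^ 2) atTop (𝓝 0) := by
    intro w hw
    have : Tendsto (fun n => w n / κ' ^ n) atTop (𝓝 0) := by
      refine squeeze_zero_norm (fun n => ?_) hs
      rw [Real.norm_eq_abs, abs_div, abs_of_pos (pow_pos h0 n), div_pow, div_le_iff₀ (pow_pos h0 n)]
      refine (hw n).trans (le_of_eq ?_)
      field_simp
    simpa using this.pow 2
  have := ((key p hp).add (key q hq)).const_mul (2 * B)
  rw [add_zero, mul_zero] at this
  refine this.congr fun n => ?_
  field_simp

/-- The sequence p solves the adjoint recursion, so its pairing with v is conserved. This expresses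
the initial data through two consecutive late values. -/
theorem backward_recurrence {a b : ℝ} (hb : b ≠ 0) {v p : ℕ → ℝ}
    (hv : ∀ n, v (n + 2) = a * v (n + 1) + b * v n)
    (hp : ∀ n, p (n + 2) = -(a / b) * p (n + 1) + 1 / b * p n) (n : ℕ) :
    p n * v n + (p (n + 1) + a / b * p n) * v (n + 1) =
      p 0 * v 0 + (p 1 + a / b * p 0) * v 1 := by
  induction n with
  | zero => rfl
  | succ n ih =>
    rw [← ih, hv, hp]
    field_simp
    ring

/-- The characteristic roots of the adjoint recursion are γ₁⁻¹ and γ₂⁻¹. -/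
theorem exists_abs_le_of_backward_recurrence {γ₁ γ₂ : ℂ} {a b ρ : ℝ} (hρ : 0 < ρ)
    (h₁ : ρ ≤ ‖γ₁‖) (h₂ : ρ ≤ ‖γ₂‖) (ha : γ₁ + γ₂ = a) (hb : γ₁ * γ₂ = -b) {p : ℕ → ℝ}
    (hp : ∀ n, p (n + 2) = -(a / b) * p (n + 1) + 1 / b * p n) :
    ∃ C, (∀ n : ℕ, |p n| ≤ C * (n + 1) * ρ⁻¹ ^ n) ∧
      ∀ n : ℕ, |p (n + 1) + a / b * p n| ≤ C * (n + 1) * ρ⁻¹ ^ n := by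
  have n₁ : γ₁ ≠ 0 := norm_pos_iff.1 (hρ.trans_le h₁)
  have n₂ : γ₂ ≠ 0 := norm_pos_iff.1 (hρ.trans_le h₂)
  have hb' : (b : ℂ) = -(γ₁ * γ₂) := by rw [hb, neg_neg]
  obtain ⟨K, hK, hw⟩ := exists_norm_le_of_recurrence (x₁ := γ₁⁻¹) (x₂ := γ₂⁻¹) (inv_pos.2 hρ)
    (by rw [norm_inv]; exact inv_anti₀ hρ h₁) (by rw [norm_inv]; exact inv_anti₀ hρ h₂)
    (fun n => (p n : ℂ)) (fun n => by
      simp only [hp]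
      push_cast
      rw [← ha, hb']
      field_simp
      ring)
  simp only [Complex.norm_real, Real.norm_eq_abs] at hw
  have hx : 0 < ρ⁻¹ := inv_pos.2 hρ
  refine ⟨K * (1 + 2 * ρ⁻¹ + |a / b|), fun n => (hw n).trans ?_, fun n => ?_⟩
  · have : K ≤ K * (1 + 2 * ρ⁻¹ + |a / b|) :=
      le_mul_of_one_le_right hK (by have := abs_nonneg (a / b); linarith)
    gcongr
  · have h1 := hw (n + 1)
    have h2 : K * (((n + 1 : ℕ) : ℝ) + 1) * ρ⁻¹ ^ (n + 1) ≤ K * (2 * (n + 1)) * ρ⁻¹ ^ (n + 1) := by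
      push_cast
      gcongr
      have : (0 : ℝ) ≤ n := Nat.cast_nonneg n
      linarith
    have h3 : |a / b| * |p n| ≤ |a / b| * (K * (n + 1) * ρ⁻¹ ^ n) := by gcongr; exact hw n
    have h4 : 0 ≤ K * (n + 1) * ρ⁻¹ ^ n := by positivity
    have h5 := abs_add_le (p (n + 1)) (a / b * p n)
    rw [abs_mul] at h5
    rw [pow_succ] at h2
    rw [pow_succ] at h1
    linarith

end Estimation

/-! ### Rates achieved by the scheme -/

section Rate

variable {Ω : Type*} [mΩ : MeasurableSpace Ω] {μ : Measure Ω} {U₁ U₂ : Ω → ℝ} {V Z : ℕ → Ω → ℝ}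

theorem hasLaw_measure_Icc_le {U : Ω → ℝ} (hU : HasLaw U (gaussianReal 0 1) μ) (t r : ℝ) :
    μ {ω | |U ω - t| ≤ r} ≤ ENNReal.ofReal (2 * r) := by
  have e : {ω | |U ω - t| ≤ r} = U ⁻¹' Set.Icc (t - r) (t + r) := by
    ext ω
    simp only [Set.mem_ofPred_eq, Set.mem_preimage, Set.mem_Icc, abs_le]
    constructor <;> rintro ⟨h1, h2⟩ <;> constructor <;> linarith
  rw [e, ← Measure.map_apply_of_aemeasurable hU.aemeasurable measurableSet_Icc, hU.map_eq]
  exact gaussianReal_Icc_le t r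

theorem le_of_forall_lt_log_inv {c ρ : ℝ} (hρ : 1 < ρ) {M : ℝ≥0∞}
    (h : ∀ κ, ρ⁻¹ < κ → κ < 1 → ENNReal.ofReal (c * -Real.log κ) ≤ M) :
    ENNReal.ofReal (c * Real.log ρ) ≤ M := by
  have h0 : 0 < ρ := one_pos.trans hρ
  have ht : Tendsto (fun κ => ENNReal.ofReal (c * -Real.log κ)) (𝓝[>] ρ⁻¹)
      (𝓝 (ENNReal.ofReal (c * Real.log ρ))) := by
    have h1 : ContinuousAt (fun κ => ENNReal.ofReal (c * -Real.log κ)) ρ⁻¹ :=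
      ENNReal.continuous_ofReal.continuousAt.comp
        ((Real.continuousAt_log (inv_ne_zero h0.ne')).neg.const_mul c)
    have h2 := h1.tendsto
    rw [Real.log_inv, neg_neg] at h2
    exact h2.mono_left nhdsWithin_le_nhds
  refine le_of_tendsto ht ?_
  filter_upwards [Ioo_mem_nhdsGT (inv_lt_one_of_one_lt₀ hρ)] with κ hκ
  exact h κ hκ.1 hκ.2

theorem one_sub_le_measureReal_of_compl [IsProbabilityMeasure μ] {s : Set Ω}
    (hs : MeasurableSet s) {ε : ℝ} (h : μ.real sᶜ ≤ ε) : 1 - ε ≤ μ.real s := by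
  rw [probReal_compl_eq_one_sub hs] at h
  linarith

/-- Both initial values are decoded to precision κⁿ. When the outputs are replaced by an independent
copy, each success costs a factor 2κⁿ; the two factors give the 2 in the rate. -/
theorem two_log_le_mutualInfoRate [IsProbabilityMeasure μ] (hV : ∀ i, Measurable (V i))
    (hV2 : ∀ i, MemLp (V i) 2 μ) (hZ : ∀ i, Measurable (Z i))
    (h₁ : HasLaw (V 0) (gaussianReal 0 1) μ) (h₂ : HasLaw (V 1) (gaussianReal 0 1) μ)
    (hind : IndepFun (V 0) (V 1) μ) {a b : ℝ} (hb : b ≠ 0)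
    (hrec : ∀ i ω, V (i + 2) ω = a * V (i + 1) ω + b * V i ω) {B : ℝ}
    (hB : ∀ n, ∫ ω, skInput μ V Z n ω ^ 2 ∂μ ≤ B) {γ₁ γ₂ : ℂ} (hγ₁ : 1 < ‖γ₁‖) (hγ₂ : 1 < ‖γ₂‖)
    (hsum : γ₁ + γ₂ = a) (hprod : γ₁ * γ₂ = -b) :
    ENNReal.ofReal (2 * Real.log (min ‖γ₁‖ ‖γ₂‖)) ≤
      mutualInfoRate μ V (channelOutput (skInput μ V Z) Z) := by
  have hρ : 1 < min ‖γ₁‖ ‖γ₂‖ := lt_min hγ₁ hγ₂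
  set ρ := min ‖γ₁‖ ‖γ₂‖
  have hρ0 : 0 < ρ := one_pos.trans hρ
  refine le_of_forall_lt_log_inv hρ fun κ hκ hκ1 => ?_
  have hκ0 : 0 < κ := (inv_pos.2 hρ0).trans hκ
  set Y := channelOutput (skInput μ V Z) Z with hYdef
  have hY : ∀ i, Measurable (Y i) := measurable_channelOutput (measurable_skInput hV hZ) hZ
  have est : ∀ (p : ℕ → ℝ) (k : ℕ),
      (∀ n, p (n + 2) = -(a / b) * p (n + 1) + 1 / b * p n) →
      (∀ ω, V k ω = p 0 * V 0 ω + (p 1 + a / b * p 0) * V 1 ω) →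
      ∃ (φ : ∀ n, (Fin (n + 2) → ℝ) → ℝ) (ε : ℕ → ℝ), (∀ n, Measurable (φ n)) ∧
        Tendsto ε atTop (𝓝 0) ∧
        ∀ n, μ.real {ω | κ ^ n < |V k ω - φ n (initSeg Y (n + 2) ω)|} ≤ ε n := by
    intro p k hp hk
    obtain ⟨C, hC, hC'⟩ := exists_abs_le_of_backward_recurrence hρ0 (min_le_left _ _)
      (min_le_right _ _) hsum hprod hp
    have hex := fun n => exists_estimator (Z := Z) hV2 hB (U := V k) (n := n) (p := p n)
      (q := p (n + 1) + a / b * p n)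
      (fun ω => by
        rw [hk]
        exact (backward_recurrence hb (v := fun n => V n ω) (fun i => hrec i ω) hp n).symm)
      (pow_pos hκ0 n)
    choose φ hφ hφe using hex
    exact ⟨φ, _, hφ, tendsto_error_bound (inv_pos.2 hρ0).le hκ hC hC' B, hφe⟩
  -- The initial data (1, -a/b) make the conserved pairing equal to V₀; the data (0, 1) below give
  -- V₁.
  obtain ⟨φ, ε, hφ, hε, hφε⟩ := est (msgCoeff (-(a / b)) (1 / b) 1 (-(a / b))) 0 (fun n => rfl)
    (fun ω => by simp [msgCoeff])
  obtain ⟨ψ, δ, hψ, hδ, hψδ⟩ := est (msgCoeff (-(a / b)) (1 / b) 0 1) 1 (fun n => rfl)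
    (fun ω => by simp [msgCoeff])
  have mV := fun n => measurable_initSeg hV (n + 2)
  have mY := fun n => measurable_initSeg hY (n + 2)
  have := fun n => Measure.isProbabilityMeasure_map (μ := μ) (mV n).aemeasurable
  have := fun n => Measure.isProbabilityMeasure_map (μ := μ) (mY n).aemeasurable
  have hs : ∀ n, MeasurableSet {x : (Fin (n + 2) → ℝ) × (Fin (n + 2) → ℝ) |
      |x.1 0 - φ n x.2| ≤ κ ^ n ∧ |x.1 1 - ψ n x.2| ≤ κ ^ n} := by
    intro n
    have m1 : Measurable fun x : (Fin (n + 2) → ℝ) × (Fin (n + 2) → ℝ) => |x.1 0 - φ n x.2| :=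
      (((measurable_pi_apply 0).comp measurable_fst).sub ((hφ n).comp measurable_snd)).abs
    have m2 : Measurable fun x : (Fin (n + 2) → ℝ) × (Fin (n + 2) → ℝ) => |x.1 1 - ψ n x.2| :=
      (((measurable_pi_apply 1).comp measurable_fst).sub ((hψ n).comp measurable_snd)).abs
    exact (measurableSet_le m1 measurable_const).inter (measurableSet_le m2 measurable_const)
  refine le_mutualInfoRate hV hY _ hs (ε := fun n => ε n + δ n) (by simpa using hε.add hδ)
    (fun n => ?_) (K := 4) (by norm_num)
    (mul_nonneg zero_le_two (neg_nonneg.2 (Real.log_nonpos hκ0.le hκ1.le))) (fun n => ?_)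
  · refine one_sub_le_measureReal_of_compl ((mV n).prodMk (mY n) (hs n)) ?_
    refine le_trans ?_ (add_le_add (hφε n) (hψδ n))
    refine le_trans (measureReal_mono fun ω hω => ?_) (measureReal_union_le _ _)
    rcases not_and_or.1 hω with h | h
    · exact Or.inl (not_le.1 h)
    · exact Or.inr (not_le.1 h)
  · have e : 4 * Real.exp (-(2 * -Real.log κ * n)) = 2 * κ ^ n * (2 * κ ^ n) := by
      have : -(2 * -Real.log κ * n) = n * Real.log κ + n * Real.log κ := by ring
      rw [this, Real.exp_add, Real.exp_nat_mul, Real.exp_log hκ0]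
      ring
    rw [e]
    refine prod_real_le_of_slices (hs n) (by positivity) fun y => ?_
    refine (Measure.map_apply (mV n) (measurable_prodMk_right (hs n))).trans_le ?_
    rw [ENNReal.ofReal_mul (by positivity)]
    -- With the output frozen at y the estimates are constants, so independence of V₀ and V₁ splits
    -- the probability.
    have hi := hind.measure_inter_preimage_eq_mul (Metric.closedBall (φ n y) (κ ^ n))
      (Metric.closedBall (ψ n y) (κ ^ n)) measurableSet_closedBall measurableSet_closedBall
    exact hi.le.trans (mul_le_mul' (hasLaw_measure_Icc_le h₁ _ _) (hasLaw_measure_Icc_le h₂ _ _))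

/-- Only V₁ is carried forward, and it is decoded as γ⁻ⁿ times the estimate of V_{n+1}. -/
theorem log_le_mutualInfoRate [IsProbabilityMeasure μ] (hV : ∀ i, Measurable (V i))
    (hV2 : ∀ i, MemLp (V i) 2 μ) (hZ : ∀ i, Measurable (Z i))
    (h₂ : HasLaw (V 1) (gaussianReal 0 1) μ) {γ : ℝ} (hγ : 1 < |γ|)
    (hrec : ∀ i ω, V (i + 1) ω = γ ^ i * V 1 ω) {B : ℝ}
    (hB : ∀ n, ∫ ω, skInput μ V Z n ω ^ 2 ∂μ ≤ B) :
    ENNReal.ofReal (Real.log |γ|) ≤ mutualInfoRate μ V (channelOutput (skInput μ V Z) Z) := by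
  rw [← one_mul (Real.log |γ|)]
  refine le_of_forall_lt_log_inv hγ fun κ hκ hκ1 => ?_
  have hγ0 : 0 < |γ| := one_pos.trans hγ
  have hγ' : γ ≠ 0 := abs_pos.1 hγ0
  have hκ0 : 0 < κ := (inv_pos.2 hγ0).trans hκ
  set Y := channelOutput (skInput μ V Z) Z with hYdef
  have hY : ∀ i, Measurable (Y i) := measurable_channelOutput (measurable_skInput hV hZ) hZ
  have hex := fun n => exists_estimator (Z := Z) hV2 hB (U := V 1) (n := n) (p := 0)
    (q := γ⁻¹ ^ n) (fun ω => by rw [hrec n, inv_pow]; field_simp; ring) (pow_pos hκ0 n)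
  choose ψ hψ hψδ using hex
  have hδ := tendsto_error_bound (p := fun _ => 0) (q := fun n => γ⁻¹ ^ n) (C := 1)
    (inv_pos.2 hγ0).le hκ (fun n => by rw [abs_zero]; positivity)
    (fun n => by
      rw [abs_pow, abs_inv]
      refine le_mul_of_one_le_left (by positivity) ?_
      have : (0 : ℝ) ≤ n := Nat.cast_nonneg n
      linarith) B
  have mV := fun n => measurable_initSeg hV (n + 2)
  have mY := fun n => measurable_initSeg hY (n + 2)
  have := fun n => Measure.isProbabilityMeasure_map (μ := μ) (mV n).aemeasurable
  have := fun n => Measure.isProbabilityMeasure_map (μ := μ) (mY n).aemeasurable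
  have hs : ∀ n, MeasurableSet {x : (Fin (n + 2) → ℝ) × (Fin (n + 2) → ℝ) |
      |x.1 1 - ψ n x.2| ≤ κ ^ n} := by
    intro n
    have m2 : Measurable fun x : (Fin (n + 2) → ℝ) × (Fin (n + 2) → ℝ) => |x.1 1 - ψ n x.2| :=
      (((measurable_pi_apply 1).comp measurable_fst).sub ((hψ n).comp measurable_snd)).abs
    exact measurableSet_le m2 measurable_const
  refine le_mutualInfoRate hV hY _ hs hδ (fun n => ?_) (K := 2) (by norm_num)
    (mul_nonneg zero_le_one (neg_nonneg.2 (Real.log_nonpos hκ0.le hκ1.le))) (fun n => ?_)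
  · refine one_sub_le_measureReal_of_compl ((mV n).prodMk (mY n) (hs n)) ?_
    refine le_trans (measureReal_mono fun ω hω => ?_) (hψδ n)
    have h : ¬ |V 1 ω - ψ n (initSeg Y (n + 2) ω)| ≤ κ ^ n := hω
    exact not_le.1 h
  · have e : 2 * Real.exp (-(1 * -Real.log κ * n)) = 2 * κ ^ n := by
      have : -(1 * -Real.log κ * n) = n * Real.log κ := by ring
      rw [this, Real.exp_nat_mul, Real.exp_log hκ0]
    rw [e]
    refine prod_real_le_of_slices (hs n) (by positivity) fun y => ?_
    refine (Measure.map_apply (mV n) (measurable_prodMk_right (hs n))).trans_le ?_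
    exact hasLaw_measure_Icc_le h₂ (ψ n y) (κ ^ n)

end Rate

/-! ### Admissibility and the capacity bounds -/

variable {p : ℕ} {β : Fin p → ℂ} {Ω : Type*} [mΩ : MeasurableSpace Ω] {μ : Measure Ω}
  {U₁ U₂ : Ω → ℝ} {Z : ℕ → Ω → ℝ} {l : Polynomial ℝ} {a b q P : ℝ} {g : PowerSeries ℝ}

/-- The message process driven by a gain satisfying the power constraint is admissible, so its
information rate bounds the capacity from below; its power is moreover uniformly bounded. -/
theorem mutualInfoRate_le_sk2Capacity [IsProbabilityMeasure μ]
    (hl : l.map Complex.ofRealHom = arPoly β) (hβ : ∀ k, ‖β k‖ < 1) (hZ : IsARNoise β μ Z)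
    (hU₁ : Measurable U₁) (hU₂ : Measurable U₂)
    (hU₁_law : HasLaw U₁ (gaussianReal 0 1) μ) (hU₂_law : HasLaw U₂ (gaussianReal 0 1) μ)
    (hU : IndepFun U₁ U₂ μ) (hUZ : IndepFun (fun ω => (U₁ ω, U₂ ω)) (fun ω i => Z i ω) μ)
    (hg : IsGain l a b q g) (hq : q ≤ P) :
    mutualInfoRate μ (message U₁ U₂ a b) (channelOutput (skInput μ (message U₁ U₂ a b) Z) Z) ≤
        sk2Capacity μ Z U₁ U₂ P ∧
      ∃ B, ∀ n, ∫ ω, skInput μ (message U₁ U₂ a b) Z n ω ^ 2 ∂μ ≤ B := by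
  have ht := tendsto_max_integral_skInput_sq hl hβ hZ hU₁ hU₂ hU₁_law hU₂_law hU hUZ hg
  refine ⟨le_sSup ⟨a, b, _, _, isSK2Pair_skInput hZ.measurable hU₁ hU₂ a b, ?_, rfl⟩, ?_⟩
  · exact (limsup_avgPower_le (memLp_skInput (memLp_message hU₁_law hU₂_law)) ht).trans
      (ENNReal.ofReal_le_ofReal hq)
  · obtain ⟨B, hB⟩ := ht.bddAbove_range
    exact ⟨B, fun n => (le_max_left _ _).trans (hB ⟨n, rfl⟩)⟩

theorem measurable_message (hU₁ : Measurable U₁) (hU₂ : Measurable U₂) (i : ℕ) :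
    Measurable (message U₁ U₂ a b i) :=
  (hU₁.const_mul _).add (hU₂.const_mul _)

/-- The scheme with a = γ and b = 0 is a degenerate SK(2) pair, which the capacity allows although
`sk2Rates` excludes b = 0. -/
theorem ofReal_sk1Rate_le_sk2Capacity [IsProbabilityMeasure μ]
    (hβ : ∀ k, ‖β k‖ < 1) (hl : l.map Complex.ofRealHom = arPoly β) (hZ : IsARNoise β μ Z)
    (hU₁ : Measurable U₁) (hU₂ : Measurable U₂)
    (hU₁_law : HasLaw U₁ (gaussianReal 0 1) μ) (hU₂_law : HasLaw U₂ (gaussianReal 0 1) μ)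
    (hU : IndepFun U₁ U₂ μ) (hUZ : IndepFun (fun ω => (U₁ ω, U₂ ω)) (fun ω i => Z i ω) μ)
    {r : ℝ} (hr : r ∈ sk1Rates β P) : ENNReal.ofReal r ≤ sk2Capacity μ Z U₁ U₂ P := by
  obtain ⟨γ, hγ, hpow, rfl⟩ := hr
  have hl' : ∀ z : ℂ, ‖z‖ ≤ 1 → (l.map Complex.ofRealHom).eval z ≠ 0 := fun z hz => by
    rw [hl]; exact LZ_ne_zero hβ hz
  obtain ⟨g, hg⟩ := exists_isGain_of_real hl' hγ (q := P) (by rw [hl]; exact hpow)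
  obtain ⟨hcap, B, hB⟩ := mutualInfoRate_le_sk2Capacity hl hβ hZ hU₁ hU₂ hU₁_law hU₂_law hU hUZ hg
    le_rfl
  refine le_trans ?_ hcap
  exact log_le_mutualInfoRate (measurable_message hU₁ hU₂) (memLp_message hU₁_law hU₂_law)
    hZ.measurable (message_one (U₁ := U₁) ▸ hU₂_law) hγ message_succ_of_zero hB

theorem ofReal_sk2Rate_le_sk2Capacity [IsProbabilityMeasure μ]
    (hβ : ∀ k, ‖β k‖ < 1) (hl : l.map Complex.ofRealHom = arPoly β) (hZ : IsARNoise β μ Z)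
    (hU₁ : Measurable U₁) (hU₂ : Measurable U₂)
    (hU₁_law : HasLaw U₁ (gaussianReal 0 1) μ) (hU₂_law : HasLaw U₂ (gaussianReal 0 1) μ)
    (hU : IndepFun U₁ U₂ μ) (hUZ : IndepFun (fun ω => (U₁ ω, U₂ ω)) (fun ω i => Z i ω) μ)
    {r : ℝ} (hr : r ∈ sk2Rates β P) : ENNReal.ofReal r ≤ sk2Capacity μ Z U₁ U₂ P := by
  obtain ⟨a, b, γ₁, γ₂, hb, hroots, h₁, h₂, hpow, rfl⟩ := hr
  have hl' : ∀ z : ℂ, ‖z‖ ≤ 1 → (l.map Complex.ofRealHom).eval z ≠ 0 := fun z hz => by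
    rw [hl]; exact LZ_ne_zero hβ hz
  have e0 := hroots 0
  have e1 := hroots 1
  have hprod : γ₁ * γ₂ = -b := by linear_combination -e0
  have hsum : γ₁ + γ₂ = a := by linear_combination e1 - e0
  obtain ⟨q, hqP, hq⟩ := (powerConstraint_iff hβ h₁ h₂).1 hpow
  obtain ⟨q', g, hg, hq', -⟩ := exists_isGain hl' h₁ h₂ hsum hprod
  rw [hl, hq] at hq'
  rw [← Complex.ofReal_injective hq'] at hg
  obtain ⟨hcap, B, hB⟩ := mutualInfoRate_le_sk2Capacity hl hβ hZ hU₁ hU₂ hU₁_law hU₂_law hU hUZ hg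
    hqP
  refine le_trans ?_ hcap
  refine two_log_le_mutualInfoRate (measurable_message hU₁ hU₂) (memLp_message hU₁_law hU₂_law)
    hZ.measurable ?_ ?_ ?_ hb message_add_two hB h₁ h₂ hsum hprod
  · rwa [message_zero]
  · rwa [message_one]
  · rwa [message_zero, message_one]

end SKChannel

theorem corollary1 {p : ℕ} (β : Fin p → ℂ) (hβ : ∀ k, ‖β k‖ < 1)
    (hreal : ∀ m, ((SKChannel.arPoly β).coeff m).im = 0)
    {Ω : Type*} [MeasurableSpace Ω] (μ : Measure Ω) [IsProbabilityMeasure μ]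
    (Z : ℕ → Ω → ℝ) (hZ : SKChannel.IsARNoise β μ Z)
    (U₁ U₂ : Ω → ℝ) (hU₁ : Measurable U₁) (hU₂ : Measurable U₂)
    (hU₁_law : HasLaw U₁ (gaussianReal 0 1) μ) (hU₂_law : HasLaw U₂ (gaussianReal 0 1) μ)
    (hU : IndepFun U₁ U₂ μ)
    (hUZ : IndepFun (fun ω => (U₁ ω, U₂ ω)) (fun ω i => Z i ω) μ)
    (P : ℝ) (hP : 0 < P) :
    ∃ I₁ I₂ : ℝ,
      IsGreatest (SKChannel.sk1Rates β P) I₁ ∧ IsGreatest (SKChannel.sk2Rates β P) I₂ ∧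
      ((max I₁ I₂ : ℝ) : EReal) ≤ ((SKChannel.sk2Capacity μ Z U₁ U₂ P : ℝ≥0∞) : EReal) := by
  obtain ⟨I₁, h₁⟩ := SKChannel.exists_isGreatest_sk1Rates hβ hreal hP
  obtain ⟨I₂, h₂⟩ := SKChannel.exists_isGreatest_sk2Rates hβ hreal hP
  obtain ⟨l, hl⟩ := SKChannel.exists_real_arPoly hreal
  refine ⟨I₁, I₂, h₁, h₂, ?_⟩
  have hmax : ENNReal.ofReal (max I₁ I₂) ≤ SKChannel.sk2Capacity μ Z U₁ U₂ P := by
    rcases max_choice I₁ I₂ with h | h <;> rw [h]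
    · exact SKChannel.ofReal_sk1Rate_le_sk2Capacity hβ hl hZ hU₁ hU₂ hU₁_law hU₂_law hU hUZ h₁.1
    · exact SKChannel.ofReal_sk2Rate_le_sk2Capacity hβ hl hZ hU₁ hU₂ hU₁_law hU₂_law hU hUZ h₂.1
  refine le_trans ?_ (EReal.coe_ennreal_le_coe_ennreal_iff.2 hmax)
  -- `ENNReal.ofReal` clips at 0, so the right side becomes a maximum with 0.
  rw [EReal.coe_ennreal_ofReal]
  exact EReal.coe_le_coe_iff.2 (le_max_left _ _)
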